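/- **Setting.** Let $k$ be a field and $q\in k^\times$. An abelian group $H$ acting by automorphisms on a ring $A$ being given, an *$H$-prime* ideal of $A$ is a proper $H$-stable two-sided ideal $P$ such that $IJ\subseteq P$ implies $I\subseteq P$ or $J\subseteq P$ for all $H$-stable two-sided ideals $I,J$; $\operatorname{Spec}_HA$ is the set of $H$-prime ideals, ordered by inclusion. Let $R$ be a (two-sided) noetherian $k$-algebra. An Ore extension $S=R[x;\tau,\delta]$ (so $S$ is a free left $R$-module with basis $1,x,x^2,\dots$, and $xr=\tau(r)x+\delta(r)$, with $\tau$ a $k$-algebra automorphism of $R$ and $\delta$ a $k$-linear $\tau$-derivation) is a *Cauchon extension* if: (i) $\delta$ is locally nilpotent; (ii) $\delta\tau=q\tau\delta$ and $q$ is not a root of unity; (iii) an abelian group $H$ acts on $S$ by $k$-algebra automorphisms; (iv) $R$ is $H$-stable and $x$ is an $H$-eigenvector; (v) there is $h_0\in H$ with $h_0|_R=\tau$ such that the $h_0$-eigenvalue of $x$ is not a root of unity; (vi) every $H$-prime ideal of $R$ is completely prime. Put $L=S[x^{-1}]$ and $$C:R\to L,\qquad C(r)=\sum_{l\ge 0}q_l\,\delta^l\tau^{-l}(r)\,x^{-l},\qquad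 q_l=q^{l(l+1)/2}\frac{(q-1)^{-l}}{(l)!_q},\qquad (l)!_q=\prod_{j=1}^{l}(1+q+\dots+q^{j-1}).$$ For $P\in\operatorname{Spec}_HR$ put $\tilde C(P)=\langle C(P)\rangle_L\cap S$ and $P_x=\langle P\cup\{x\}\rangle_S$ (two-sided ideals generated in $L$ and in $S$). Put $$\mathcal P_3=\{P\in\operatorname{Spec}_HR:\delta(R)\subseteq P\},\quad \mathcal P_2=\{P\in\operatorname{Spec}_HR:\delta(P)\subseteq P\}\setminus\mathcal P_3,\quad \mathcal P_1=\operatorname{Spec}_HR\setminus(\mathcal P_2\cup\mathcal P_3).$$ Let $W$ be a Coxeter group with a fixed set of Coxeter generators, $\le$ its Bruhat order, $W^{\le w}=\{u\in W:u\le w\}$. Let $a$ be a generator and $\bar w\in W$ with $\bar w<\bar wa$. Put $$W_1=\{w\in W^{\le\bar w}:wa\le w\},\quad W_2=\{w\in W^{\le\bar w}:w\le wa\le\bar w\},\quad W_3=\{w\in W^{\le\bar w}:wa\not\le\bar w\},$$ and $\Phi(w)=w$ if $w\le wa$, $\Phi(w)=wa$ if $wa\le w$. **Theorem.** Let $S=R[x;\tau,\delta]$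 be a Cauchon extension such that $\tau$ acts diagonalizably on $R$ (that is, $R$ is spanned over $k$ by $\tau$-eigenvectors). Let $W$, $a$, $\bar w$ be as above and let $\nabla:W^{\le\bar w}\to\operatorname{Spec}_HR$ be an isomorphism of posets with $\nabla(W_i)=\mathcal P_i$ for $i=1,2,3$. Then $\tilde C\nabla$ extends to an isomorphism of posets $\tilde\nabla:W^{\le\bar wa}\to\operatorname{Spec}_HS$, such that $$\tilde\nabla(w)=\begin{cases}\tilde C(\nabla(w)),& w\le\bar w,\\ (\nabla(wa))_x,& w\not\le\bar w\ \text{(in which case } wa\le\bar w),\end{cases}$$ and, for every $w\in W^{\le\bar wa}$, one has $\Phi(w)\le\bar w$ and $\tilde\nabla(w)\cap R=\nabla(\Phi(w))$. -/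

import Mathlib

/-! ### Bruhat order on a Coxeter group -/

namespace CoxeterSystem

/-- An elementary step of the Bruhat order: `v = u t` for a reflection `t`, with `ℓ u < ℓ v`. -/
def BruhatStep {B W : Type*} [Group W] {M : CoxeterMatrix B} (cs : CoxeterSystem M W)
    (u v : W) : Prop :=
  ∃ t, cs.IsReflection t ∧ v = u * t ∧ cs.length u < cs.length v

/-- The Bruhat order: the reflexive transitive closure of the elementary steps. -/
def BruhatLE {B W : Type*} [Group W] {M : CoxeterMatrix B} (cs : CoxeterSystem M W)
    (u v : W) : Prop :=
  Relation.ReflTransGen cs.BruhatStep u v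

theorem BruhatLE.eq_or_length_lt {B W : Type*} [Group W] {M : CoxeterMatrix B}
    {cs : CoxeterSystem M W} {u v : W} (h : cs.BruhatLE u v) :
    u = v ∨ cs.length u < cs.length v := by
  induction h with
  | refl => exact Or.inl rfl
  | tail _ hstep ih =>
    obtain ⟨_, _, _, hlt⟩ := hstep
    rcases ih with rfl | ih
    · exact Or.inr hlt
    · exact Or.inr (ih.trans hlt)

/-- The Bruhat interval `W^{≤ w} = {u ∈ W : u ≤ w}`. -/
def BruhatInterval {B W : Type*} [Group W] {M : CoxeterMatrix B} (cs : CoxeterSystem M W)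
    (w : W) : Type _ :=
  {u : W // cs.BruhatLE u w}

/-- The interval carries the Bruhat order. -/
instance {B W : Type*} [Group W] {M : CoxeterMatrix B} (cs : CoxeterSystem M W) (w : W) :
    PartialOrder (cs.BruhatInterval w) where
  le u v := cs.BruhatLE u.1 v.1
  le_refl _ := Relation.ReflTransGen.refl
  le_trans _ _ _ h₁ h₂ := Relation.ReflTransGen.trans h₁ h₂
  le_antisymm u v h₁ h₂ := by
    rcases BruhatLE.eq_or_length_lt h₁ with h | h
    · exact Subtype.ext h
    · rcases BruhatLE.eq_or_length_lt h₂ with h' | h'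
      · exact Subtype.ext h'.symm
      · exact absurd (h.trans h') (lt_irrefl _)

/-- `W₁ = {u ∈ W^{≤ w} : u a ≤ u}`. -/
def bruhatPiece₁ {B W : Type*} [Group W] {M : CoxeterMatrix B} (cs : CoxeterSystem M W)
    (w a : W) : Set (cs.BruhatInterval w) :=
  {u | cs.BruhatLE (u.1 * a) u.1}

/-- `W₂ = {u ∈ W^{≤ w} : u ≤ u a ≤ w}`. -/
def bruhatPiece₂ {B W : Type*} [Group W] {M : CoxeterMatrix B} (cs : CoxeterSystem M W)
    (w a : W) : Set (cs.BruhatInterval w) :=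
  {u | cs.BruhatLE u.1 (u.1 * a) ∧ cs.BruhatLE (u.1 * a) w}

/-- `W₃ = {u ∈ W^{≤ w} : u a ≰ w}`. -/
def bruhatPiece₃ {B W : Type*} [Group W] {M : CoxeterMatrix B} (cs : CoxeterSystem M W)
    (w a : W) : Set (cs.BruhatInterval w) :=
  {u | ¬ cs.BruhatLE (u.1 * a) w}

open Classical in
/-- The projection `Φ`: it sends `u` to `u` if `u ≤ u a`, and to `u a` otherwise. -/
noncomputable def bruhatProj {B W : Type*} [Group W] {M : CoxeterMatrix B}
    (cs : CoxeterSystem M W) (a u : W) : W :=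
  if cs.BruhatLE u (u * a) then u else u * a

end CoxeterSystem

/-! ### `H`-prime and completely prime ideals -/

/-- A two-sided ideal stable under the action of `H`. -/
def TwoSidedIdeal.IsStable (H : Type*) {A : Type*} [Ring A] [Group H] [MulSemiringAction H A]
    (I : TwoSidedIdeal A) : Prop :=
  ∀ (h : H) (a : A), a ∈ I → h • a ∈ I

/-- An `H`-prime ideal: a proper `H`-stable ideal `P` such that, for all `H`-stable ideals `I` and
`J`, `I J ⊆ P` implies `I ⊆ P` or `J ⊆ P`. -/
structure TwoSidedIdeal.IsHPrime (H : Type*) {A : Type*} [Ring A] [Group H]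
    [MulSemiringAction H A] (P : TwoSidedIdeal A) : Prop where
  ne_top : P ≠ ⊤
  stable : P.IsStable H
  le_or_le : ∀ I J : TwoSidedIdeal A, I.IsStable H → J.IsStable H →
    (∀ a ∈ I, ∀ b ∈ J, a * b ∈ P) → I ≤ P ∨ J ≤ P

/-- A completely prime ideal: the quotient is a domain. -/
structure TwoSidedIdeal.IsCompletelyPrime {A : Type*} [Ring A] (P : TwoSidedIdeal A) : Prop where
  ne_top : P ≠ ⊤
  mem_or_mem : ∀ a b : A, a * b ∈ P → a ∈ P ∨ b ∈ P

/-- The `H`-prime spectrum `Spec_H A`, ordered by inclusion. -/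
abbrev HSpec (H A : Type*) [Ring A] [Group H] [MulSemiringAction H A] : Type _ :=
  {P : TwoSidedIdeal A // P.IsHPrime H}

/-! ### Ore extensions and Cauchon extensions -/

/-- `S = R[x; τ, δ]`, where `R` is regarded as a subalgebra of `S` via `ι`: the powers of `x` form
a basis of `S` as a left `R`-module, `δ` is a `τ`-derivation, and `x r = τ(r) x + δ(r)`. -/
structure IsOreExtension {k R S : Type*} [Field k] [Ring R] [Algebra k R] [Ring S] [Algebra k S]
    (ι : R →ₐ[k] S) (x : S) (τ : R ≃ₐ[k] R) (δ : R →ₗ[k] R) : Prop where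
  skew : ∀ a b : R, δ (a * b) = τ a * δ b + δ a * b
  basis : Function.Bijective fun f : ℕ →₀ R => f.sum fun n r => ι r * x ^ n
  commute : ∀ r : R, x * ι r = ι (τ r) * x + ι (δ r)

/-- `S = R[x; τ, δ]` is a Cauchon extension with respect to the group `H` and the scalar `q`.
That `R` is `H`-stable is expressed by `ι` being equivariant for an action of `H` on `R`. -/
structure IsCauchonExtension (H : Type*) {k R S : Type*} [Field k] [Ring R] [Algebra k R]
    [Ring S] [Algebra k S] [CommGroup H] [MulSemiringAction H R] [MulSemiringAction H S]
    (ι : R →ₐ[k] S) (x : S) (τ : R ≃ₐ[k] R) (δ : R →ₗ[k] R) (q : kˣ) : Prop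
    extends IsOreExtension ι x τ δ where
  noetherian_left : IsNoetherianRing R
  noetherian_right : IsNoetherianRing Rᵐᵒᵖ
  locally_nilpotent : ∀ r : R, ∃ n : ℕ, (δ ^ n) r = 0
  q_commute : ∀ r : R, δ (τ r) = (q : k) • τ (δ r)
  q_not_root : ∀ n : ℕ, 0 < n → (q : k) ^ n ≠ 1
  smul_scalar : ∀ (h : H) (c : k) (s : S), h • (c • s) = c • (h • s)
  equivariant : ∀ (h : H) (r : R), h • ι r = ι (h • r)
  eigenvector : ∀ h : H, ∃ c : k, h • x = c • x
  exists_h₀ : ∃ h₀ : H, (∀ r : R, h₀ • r = τ r) ∧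
    ∃ c : k, h₀ • x = c • x ∧ ∀ n : ℕ, 0 < n → c ^ n ≠ 1
  completely_prime : ∀ P : TwoSidedIdeal R, P.IsHPrime H → P.IsCompletelyPrime

/-! ### The localization `L = S[x⁻¹]` -/

theorem IsOreExtension.eq_zero_of_mul_x {k R S : Type*} [Field k] [Ring R] [Algebra k R] [Ring S]
    [Algebra k S] {ι : R →ₐ[k] S} {x : S} {τ : R ≃ₐ[k] R} {δ : R →ₗ[k] R}
    (h : IsOreExtension ι x τ δ) {s : S} (hs : s * x = 0) : s = 0 := by
  obtain ⟨f, rfl⟩ := h.basis.2 s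
  have h1 : (fun f : ℕ →₀ R => f.sum fun n r => ι r * x ^ n) (f.mapDomain Nat.succ) = 0 := by
    rw [← hs]
    simp only
    rw [Finsupp.sum_mapDomain_index (by simp) (by intros; simp [add_mul]), Finsupp.sum,
      Finsupp.sum, Finset.sum_mul]
    simp [pow_succ, mul_assoc]
  have h2 : f.mapDomain Nat.succ = 0 := h.basis.1 (by rw [h1]; simp)
  have h3 : f = 0 := Finsupp.mapDomain_injective Nat.succ_injective (by rw [h2]; simp)
  simp [h3]

theorem IsOreExtension.eq_of_mul_x_pow {k R S : Type*} [Field k] [Ring R] [Algebra k R] [Ring S]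
    [Algebra k S] {ι : R →ₐ[k] S} {x : S} {τ : R ≃ₐ[k] R} {δ : R →ₗ[k] R}
    (h : IsOreExtension ι x τ δ) (n : ℕ) {s t : S} (hst : s * x ^ n = t * x ^ n) : s = t := by
  induction n with
  | zero => simpa using hst
  | succ n ih =>
    apply ih
    rw [pow_succ, ← mul_assoc, ← mul_assoc] at hst
    exact sub_eq_zero.mp (h.eq_zero_of_mul_x (by rw [sub_mul, hst, sub_self]))

theorem IsOreExtension.exists_pow_mul {k R S : Type*} [Field k] [Ring R] [Algebra k R] [Ring S]
    [Algebra k S] {ι : R →ₐ[k] S} {x : S} {τ : R ≃ₐ[k] R} {δ : R →ₗ[k] R}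
    (h : IsOreExtension ι x τ δ) (hδ : ∀ r : R, ∃ n : ℕ, (δ ^ n) r = 0) (n : ℕ) (s : S) :
    ∃ (m : ℕ) (s' : S), x ^ m * s = s' * x ^ n := by
  have hR : ∀ (n : ℕ) (r : R), (δ ^ n) r = 0 → ∃ (m : ℕ) (s' : S), x ^ m * ι r = s' * x := by
    intro n
    induction n with
    | zero => exact fun r hr => ⟨0, 0, by simp at hr; simp [hr]⟩
    | succ n ih =>
      intro r hr
      obtain ⟨m, s', hm⟩ := ih (δ r) (by rw [pow_succ] at hr; exact hr)
      exact ⟨m + 1, x ^ m * ι (τ r) + s', by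
        rw [pow_succ, mul_assoc, h.commute, mul_add, hm, add_mul, mul_assoc]⟩
  have hS : ∀ s : S, ∃ (m : ℕ) (s' : S), x ^ m * s = s' * x := by
    intro s
    obtain ⟨f, rfl⟩ := h.basis.2 s
    refine Finset.sum_induction _ (fun s => ∃ (m : ℕ) (s' : S), x ^ m * s = s' * x) ?_ ?_ ?_
    · rintro s t ⟨m, s', hs⟩ ⟨m', t', ht⟩
      refine ⟨m' + m, x ^ m' * s' + x ^ m * t', ?_⟩
      rw [mul_add, add_mul, mul_assoc _ s', mul_assoc _ t', ← hs, ← ht, ← mul_assoc, ← mul_assoc,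
        ← pow_add, ← pow_add, add_comm m m']
    · exact ⟨0, 0, by simp⟩
    · intro i _
      cases i with
      | zero =>
        obtain ⟨n, hn⟩ := hδ (f 0)
        obtain ⟨m, s', hm⟩ := hR n _ hn
        exact ⟨m, s', by simpa using hm⟩
      | succ i => exact ⟨0, ι (f (i + 1)) * x ^ i, by simp [pow_succ, mul_assoc]⟩
  induction n generalizing s with
  | zero => exact ⟨0, s, by simp⟩
  | succ n ih =>
    obtain ⟨m, s', hm⟩ := hS s
    obtain ⟨m', s'', hm'⟩ := ih s'
    exact ⟨m' + m, s'', by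
      rw [pow_add, mul_assoc, hm, ← mul_assoc, hm', mul_assoc, ← pow_succ]⟩

namespace IsCauchonExtension

/-- The powers of `x` form an Ore set in a Cauchon extension. -/
noncomputable abbrev oreSet {H k R S : Type*} [Field k] [Ring R] [Algebra k R]
    [Ring S] [Algebra k S] [CommGroup H] [MulSemiringAction H R] [MulSemiringAction H S]
    {ι : R →ₐ[k] S} {x : S} {τ : R ≃ₐ[k] R} {δ : R →ₗ[k] R} {q : kˣ}
    (h : IsCauchonExtension H ι x τ δ q) : OreLocalization.OreSet (Submonoid.powers x) :=
  Classical.choice <| OreLocalization.nonempty_oreSet_iff.mpr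
    ⟨fun _ _ ⟨_, n, hn⟩ hst => ⟨1, by
        subst hn
        rw [h.toIsOreExtension.eq_of_mul_x_pow n hst]⟩,
      fun s ⟨_, n, hn⟩ => by
        subst hn
        obtain ⟨m, s', hm⟩ := h.toIsOreExtension.exists_pow_mul h.locally_nilpotent n s
        exact ⟨s', ⟨x ^ m, m, rfl⟩, hm⟩⟩

/-- The localization `L = S[x⁻¹]`. -/
def Loc {H k R S : Type*} [Field k] [Ring R] [Algebra k R]
    [Ring S] [Algebra k S] [CommGroup H] [MulSemiringAction H R] [MulSemiringAction H S]
    {ι : R →ₐ[k] S} {x : S} {τ : R ≃ₐ[k] R} {δ : R →ₗ[k] R} {q : kˣ}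
    (h : IsCauchonExtension H ι x τ δ q) : Type _ :=
  letI := h.oreSet
  OreLocalization (Submonoid.powers x) S

noncomputable instance {H k R S : Type*} [Field k] [Ring R] [Algebra k R]
    [Ring S] [Algebra k S] [CommGroup H] [MulSemiringAction H R] [MulSemiringAction H S]
    {ι : R →ₐ[k] S} {x : S} {τ : R ≃ₐ[k] R} {δ : R →ₗ[k] R} {q : kˣ}
    (h : IsCauchonExtension H ι x τ δ q) : Ring h.Loc :=
  letI := h.oreSet
  inferInstanceAs (Ring (OreLocalization (Submonoid.powers x) S))

/-- The canonical map `S → L`. -/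
noncomputable def toLoc {H k R S : Type*} [Field k] [Ring R] [Algebra k R]
    [Ring S] [Algebra k S] [CommGroup H] [MulSemiringAction H R] [MulSemiringAction H S]
    {ι : R →ₐ[k] S} {x : S} {τ : R ≃ₐ[k] R} {δ : R →ₗ[k] R} {q : kˣ}
    (h : IsCauchonExtension H ι x τ δ q) : S →+* h.Loc :=
  letI := h.oreSet
  (OreLocalization.numeratorRingHom : S →+* OreLocalization (Submonoid.powers x) S)

/-- The element `x⁻¹` of `L`. -/
noncomputable def invX {H k R S : Type*} [Field k] [Ring R] [Algebra k R]
    [Ring S] [Algebra k S] [CommGroup H] [MulSemiringAction H R] [MulSemiringAction H S]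
    {ι : R →ₐ[k] S} {x : S} {τ : R ≃ₐ[k] R} {δ : R →ₗ[k] R} {q : kˣ}
    (h : IsCauchonExtension H ι x τ δ q) : h.Loc :=
  letI := h.oreSet
  ((1 : S) /ₒ (⟨x, Submonoid.mem_powers x⟩ : Submonoid.powers x) :
    OreLocalization (Submonoid.powers x) S)

end IsCauchonExtension

/-! ### The deleting-derivation map -/

/-- The `q`-factorial `(l)!_q = ∏_{j = 1}^{l} (1 + q + ⋯ + q^{j - 1})`. -/
def qFactorial {k : Type*} [Field k] (q : k) (l : ℕ) : k :=
  ∏ j ∈ Finset.range l, ∑ i ∈ Finset.range (j + 1), q ^ i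

/-- The scalar `q_l = q^{l(l+1)/2} (q - 1)^{-l} / (l)!_q`. -/
def cauchonCoeff {k : Type*} [Field k] (q : k) (l : ℕ) : k :=
  q ^ (l * (l + 1) / 2) * ((q - 1) ^ l)⁻¹ / qFactorial q l

namespace IsCauchonExtension

/-- Cauchon's homomorphism `C : R → L`, `C(r) = ∑_l q_l δ^l τ^{-l}(r) x^{-l}`. The sum is finite,
because `δ` is locally nilpotent and `δ τ = q τ δ`. -/
noncomputable def cauchonMap {H k R S : Type*} [Field k] [Ring R] [Algebra k R]
    [Ring S] [Algebra k S] [CommGroup H] [MulSemiringAction H R] [MulSemiringAction H S]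
    {ι : R →ₐ[k] S} {x : S} {τ : R ≃ₐ[k] R} {δ : R →ₗ[k] R} {q : kˣ}
    (h : IsCauchonExtension H ι x τ δ q) (r : R) : h.Loc :=
  ∑ᶠ l : ℕ, h.toLoc (ι (cauchonCoeff (q : k) l • (δ ^ l) (τ.symm^[l] r))) * h.invX ^ l

/-- `C̃(P) = ⟨C(P)⟩_L ∩ S`. -/
noncomputable def cauchonTilde {H k R S : Type*} [Field k] [Ring R] [Algebra k R]
    [Ring S] [Algebra k S] [CommGroup H] [MulSemiringAction H R] [MulSemiringAction H S]
    {ι : R →ₐ[k] S} {x : S} {τ : R ≃ₐ[k] R} {δ : R →ₗ[k] R} {q : kˣ}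
    (h : IsCauchonExtension H ι x τ δ q) (P : TwoSidedIdeal R) : TwoSidedIdeal S :=
  (TwoSidedIdeal.span (h.cauchonMap '' (P : Set R))).comap h.toLoc

end IsCauchonExtension

/-! ### The pieces of `Spec_H R` -/

/-- `P₃ = {P ∈ Spec_H R : δ(R) ⊆ P}`. -/
def specPiece₃ (H : Type*) {k R : Type*} [Field k] [Ring R] [Algebra k R] [Group H]
    [MulSemiringAction H R] (δ : R →ₗ[k] R) : Set (HSpec H R) :=
  {P | ∀ r : R, δ r ∈ P.1}

/-- `P₂ = {P ∈ Spec_H R : δ(P) ⊆ P} ∖ P₃`. -/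
def specPiece₂ (H : Type*) {k R : Type*} [Field k] [Ring R] [Algebra k R] [Group H]
    [MulSemiringAction H R] (δ : R →ₗ[k] R) : Set (HSpec H R) :=
  {P | ∀ r ∈ P.1, δ r ∈ P.1} \ specPiece₃ H δ

/-- `P₁ = Spec_H R ∖ (P₂ ∪ P₃)`. -/
def specPiece₁ (H : Type*) {k R : Type*} [Field k] [Ring R] [Algebra k R] [Group H]
    [MulSemiringAction H R] (δ : R →ₗ[k] R) : Set (HSpec H R) :=
  (specPiece₂ H δ ∪ specPiece₃ H δ)ᶜ

/-! The `H`-primes of `S` fall into two families. Those containing `x` are the ideals `constIdeal P`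
= `P_x` with `δ(R) ⊆ P`. The others contain no power of `x` and are the ideals `homogIdeal N` =
`C̃(N)`, with `N` an arbitrary `H`-prime of `R` (`eq_constIdeal_or_eq_homogIdeal`). Three facts
determine the order. Within the second family it is the order of `Spec_H R` (`homogIdeal_le_iff`).
No `P_x` lies in a `C̃(N)`, since `x` does not. An `H`-stable `Q` lies in `P_x` exactly when `Q ∩ R
⊆ P` (`le_constIdeal`).

Contractions therefore decide everything. `C̃(N) ∩ R` is the largest `H`- and `δ`-stable ideal
inside `N`, and it is again `H`-prime (`isCompletelyPrime_comap`). Under `nabla`, `δ`-stability of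
an ideal means `u ≤ u a`, so the contraction corresponds to the largest `v ≤ u` with `v ≤ v a`,
which is `Φ(u)`. On the Coxeter side the lifting property gives `Φ(u) ≤ v ↔ u ≤ v a` whenever `v ≤ v
a` (`bruhatProj_le_iff`), and this matches the comparison with `P_x`.

The localization is mostly avoided. With `h₀` acting as `τ` on `R` and `λ` the `h₀`-eigenvalue of
`x`, the elements `C(r) x ^ p` lying in `S` are the `s` with `λ ^ p x s = (h₀ s) x` (`IsHomog`).
Such an element is determined by `p` and its coefficient at `x ^ p`, because `λ` is not a root of
unity. Up to right multiplication by powers of `x`, every element of `S` is a sum of them, and their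
leading coefficients multiply with a twist by `τ`. So `S` behaves like a skew polynomial ring
without derivation, and `H`-stable ideals can be split into homogeneous components. -/

/-! ### Reflections and the lifting property of the Bruhat order -/

namespace CoxeterSystem

variable {B W : Type*} [Group W] {M : CoxeterMatrix B} (cs : CoxeterSystem M W)

open Classical in
/-- The permutation `(t, z) ↦ (s t s, z + [t = s])` of `W × ZMod 2` attached to a simple
reflection `s`. -/
noncomputable def signedConj (i : B) : Equiv.Perm (W × ZMod 2) :=
  Function.Involutive.toPerm
    (fun p => (cs.simple i * p.1 * cs.simple i, p.2 + if p.1 = cs.simple i then 1 else 0)) <| by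
    rintro ⟨t, z⟩
    have h : cs.simple i * t * cs.simple i = cs.simple i ↔ t = cs.simple i := by
      constructor
      · intro h
        have := congrArg (fun u => cs.simple i * u * cs.simple i) h
        simpa [mul_assoc] using this
      · rintro rfl; simp
    have h2 : ∀ a : ZMod 2, a + a = 0 := by decide
    simp only [h, Prod.mk.injEq]
    constructor
    · simp [mul_assoc]
    · rw [add_assoc, h2, add_zero]

open Classical in
theorem signedConj_apply (i : B) (t : W) (z : ZMod 2) :
    cs.signedConj i (t, z) =
      (cs.simple i * t * cs.simple i, z + if t = cs.simple i then 1 else 0) := rfl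

-- The elements `s_j (s_i s_j) ^ k` are the reflections of the dihedral group generated by `s_i` and
-- `s_j`. Each further factor tests `t` against the next two of them, because conjugation by `s_j`
-- inverts `s_i s_j`.
open Classical in
theorem signedConj_mul_pow_apply (i j : B) (m : ℕ) (t : W) (z : ZMod 2) :
    ((cs.signedConj i * cs.signedConj j) ^ m) (t, z) =
      ((cs.simple i * cs.simple j) ^ m * t * ((cs.simple i * cs.simple j) ^ m)⁻¹,
        z + ∑ k ∈ Finset.range (2 * m),
          if t = cs.simple j * (cs.simple i * cs.simple j) ^ k then 1 else 0) := by
  set p := cs.simple i * cs.simple j with hp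
  have hpj : ∀ k : ℕ, (p ^ k)⁻¹ * cs.simple j = cs.simple j * p ^ k := by
    intro k
    have h1 : p⁻¹ = cs.simple j * p * (cs.simple j)⁻¹ := by simp [hp, mul_assoc]
    rw [← inv_pow, h1, conj_pow]
    simp
  induction m with
  | zero => simp
  | succ m ih =>
    have e1 : (p ^ m * t * (p ^ m)⁻¹ = cs.simple j) ↔ t = cs.simple j * p ^ (2 * m) := by
      rw [two_mul, pow_add, ← mul_assoc, ← hpj]
      constructor
      · rintro h; rw [← h]; group
      · rintro rfl; group
    have e2 : (cs.simple j * (p ^ m * t * (p ^ m)⁻¹) * cs.simple j = cs.simple i) ↔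
        t = cs.simple j * p ^ (2 * m + 1) := by
      have : cs.simple j * p ^ (2 * m + 1) = (p ^ m)⁻¹ * (cs.simple j * cs.simple i *
          cs.simple j) * p ^ m := by
        rw [two_mul, add_right_comm, pow_add, ← mul_assoc, ← hpj, pow_succ']
        have := hpj 1
        simp only [pow_one] at this
        simp [hp, mul_assoc]
      rw [this]
      constructor
      · rintro h; rw [← h]; simp [mul_assoc]
      · rintro rfl; simp [mul_assoc]
    rw [pow_succ', Equiv.Perm.mul_apply, ih, Equiv.Perm.mul_apply, signedConj_apply,
      signedConj_apply, show 2 * (m + 1) = 2 * m + 1 + 1 by ring, Finset.sum_range_succ,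
      Finset.sum_range_succ]
    simp only [e1, e2, Prod.mk.injEq]
    constructor
    · rw [pow_succ']
      simp [hp, mul_assoc]
    · ring

/-- At `m = M i j` the list of `2 m` reflections runs twice through the same `m` elements, since
`(s_i s_j) ^ m = 1`; every count is then even and vanishes in `ZMod 2`. -/
theorem isLiftable_signedConj : M.IsLiftable cs.signedConj := by
  classical
  intro i j
  ext1 ⟨t, z⟩
  have hp := cs.simple_mul_simple_pow i j
  have h2 : ∀ a : ZMod 2, a + a = 0 := by decide
  rw [signedConj_mul_pow_apply, hp, two_mul, Finset.sum_range_add]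
  simp only [pow_add, hp, one_mul, h2]
  simp

/-- The action of `W` on `W × ZMod 2` that counts the reflections inverted by a word modulo `2`. -/
noncomputable def signedConjHom : W →* Equiv.Perm (W × ZMod 2) :=
  cs.lift ⟨cs.signedConj, cs.isLiftable_signedConj⟩

theorem signedConjHom_simple (i : B) : cs.signedConjHom (cs.simple i) = cs.signedConj i :=
  cs.lift_apply_simple _ i

/-- The parity with which `t` occurs in the right inversion sequences of the words for `w`. -/
noncomputable def inversionParity (w t : W) : ZMod 2 := (cs.signedConjHom w (t, 0)).2

open Classical in
theorem signedConjHom_wordProd (ω : List B) (t : W) (z : ZMod 2) :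
    cs.signedConjHom (cs.wordProd ω) (t, z) =
      (cs.wordProd ω * t * (cs.wordProd ω)⁻¹, z + (cs.rightInvSeq ω).count t) := by
  induction ω with
  | nil => simp [rightInvSeq]
  | cons i ω ih =>
    rw [wordProd_cons, map_mul, Equiv.Perm.mul_apply, ih, signedConjHom_simple, signedConj_apply,
      rightInvSeq, List.count_cons]
    have h : (cs.wordProd ω * t * (cs.wordProd ω)⁻¹ = cs.simple i) ↔
        ((cs.wordProd ω)⁻¹ * cs.simple i * cs.wordProd ω = t) := by
      constructor
      · rintro h; rw [← h]; simp [mul_assoc]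
      · rintro rfl; simp [mul_assoc]
    simp only [h, beq_iff_eq, Prod.mk.injEq]
    constructor
    · simp [mul_assoc]
    · push_cast; ring

theorem signedConjHom_apply (w t : W) (z : ZMod 2) :
    cs.signedConjHom w (t, z) = (w * t * w⁻¹, z + cs.inversionParity w t) := by
  classical
  obtain ⟨ω, _, rfl⟩ := cs.exists_isReduced w
  simp [inversionParity, signedConjHom_wordProd]

theorem inversionParity_mul (v w t : W) :
    cs.inversionParity (v * w) t =
      cs.inversionParity w t + cs.inversionParity v (w * t * w⁻¹) := by
  have := cs.signedConjHom_apply (v * w) t 0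
  rw [map_mul, Equiv.Perm.mul_apply, signedConjHom_apply, signedConjHom_apply] at this
  simpa using (congrArg Prod.snd this).symm

open Classical in
theorem inversionParity_simple (i : B) (t : W) :
    cs.inversionParity (cs.simple i) t = if t = cs.simple i then 1 else 0 := by
  simp [inversionParity, signedConjHom_simple, signedConj_apply]

/-- For `t = w s w⁻¹` the contributions of `w` and `w⁻¹` cancel, as they do in `w w⁻¹ = 1`, and only
the contribution `1` of `s` at itself remains. -/
theorem IsReflection.inversionParity_self {t : W} (ht : cs.IsReflection t) :
    cs.inversionParity t t = 1 := by
  obtain ⟨w, i, rfl⟩ := ht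
  have h0 : cs.inversionParity (w * w⁻¹) (w * cs.simple i * w⁻¹) = 0 := by
    simp [inversionParity]
  rw [inversionParity_mul] at h0
  rw [inversionParity_mul, inversionParity_mul]
  have e1 : w⁻¹ * (w * cs.simple i * w⁻¹) * w⁻¹⁻¹ = cs.simple i := by simp [mul_assoc]
  rw [e1] at h0 ⊢
  have e2 : cs.simple i * cs.simple i * (cs.simple i)⁻¹ = cs.simple i := by simp
  rw [e2, inversionParity_simple, if_pos rfl, add_left_comm, h0, add_zero]

/-- An odd count is nonzero, so `t` occurs in the inversion sequence of a reduced word and is a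
right inversion. -/
theorem length_mul_lt_of_inversionParity {w t : W} (h : cs.inversionParity w t = 1) :
    cs.length (w * t) < cs.length w := by
  classical
  obtain ⟨ω, hω, rfl⟩ := cs.exists_isReduced w
  refine (cs.isRightInversion_of_mem_rightInvSeq hω ?_).2
  by_contra hmem
  rw [inversionParity, signedConjHom_wordProd, List.count_eq_zero_of_not_mem hmem] at h
  simp at h

/-- For the converse, `w` and `w t` have opposite parities at `t`; if that of `w` were `0`, then
passing from `w t` to `w t t = w` would shorten. -/
theorem IsReflection.length_mul_lt_iff {w t : W} (ht : cs.IsReflection t) :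
    cs.length (w * t) < cs.length w ↔ cs.inversionParity w t = 1 := by
  refine ⟨fun h => ?_, cs.length_mul_lt_of_inversionParity⟩
  by_contra hne
  have h0 : cs.inversionParity w t = 0 := by
    have : ∀ a : ZMod 2, a ≠ 1 → a = 0 := by decide
    exact this _ hne
  have h1 : cs.inversionParity (w * t) t = 1 := by
    rw [inversionParity_mul, IsReflection.inversionParity_self cs ht]
    simp [h0]
  have := cs.length_mul_lt_of_inversionParity h1
  rw [mul_assoc, ht.mul_self, mul_one] at this
  exact absurd (h.trans this) (lt_irrefl _)

/-- Whether a reflection raises the length is read off from the parity. Since `t ≠ s`, the parity of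
`u s` at `s t s` equals that of `u` at `t`, so the step remains upward. -/
theorem BruhatStep.mul_simple {u v : W} {cs : CoxeterSystem M W} (h : cs.BruhatStep u v) (i : B)
    (hne : v ≠ u * cs.simple i) : cs.BruhatStep (u * cs.simple i) (v * cs.simple i) := by
  obtain ⟨t, ht, rfl, hlt⟩ := h
  have hts : t ≠ cs.simple i := fun h => hne (by rw [h])
  have ht' : cs.IsReflection (cs.simple i * t * cs.simple i) := by
    simpa using ht.conj (cs.simple i)
  have e : u * t * cs.simple i = u * cs.simple i * (cs.simple i * t * cs.simple i) := by
    simp [mul_assoc]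
  refine ⟨_, ht', e, ?_⟩
  have h1 : ¬ cs.inversionParity u t = 1 := fun h =>
    absurd (hlt.trans (cs.length_mul_lt_of_inversionParity h)) (lt_irrefl _)
  have h2 : cs.inversionParity (u * cs.simple i) (cs.simple i * t * cs.simple i) =
      cs.inversionParity u t := by
    classical
    have hn : ¬ cs.simple i * t * cs.simple i = cs.simple i := fun h => hts (by
      have := congrArg (fun u => cs.simple i * u * cs.simple i) h
      simpa [mul_assoc] using this)
    rw [inversionParity_mul, inversionParity_simple, if_neg hn, zero_add]
    simp [mul_assoc]
  rw [← h2, ← IsReflection.length_mul_lt_iff cs ht', ← e, not_lt] at h1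
  rw [e] at h1 ⊢
  exact lt_of_le_of_ne h1 (ht'.length_mul_left_ne _).symm

/-! ### The lifting property of the Bruhat order. -/

variable {cs}

/-- Multiply a chain from `u` to `v` by the simple reflection step by step. The only step that may
break is `v' → v' s`, and there the translated chain has already reached the upper end. -/
theorem BruhatLE.mul_simple {u v : W} (h : cs.BruhatLE u v) (i : B) :
    cs.BruhatLE (u * cs.simple i) v ∨ cs.BruhatLE (u * cs.simple i) (v * cs.simple i) := by
  induction h with
  | refl => exact Or.inr .refl
  | @tail v w h hs ih =>
    rcases ih with ih | ih
    · exact Or.inl (ih.tail hs)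
    · by_cases hne : w = v * cs.simple i
      · exact Or.inl (hne ▸ ih)
      · exact Or.inr (ih.tail (hs.mul_simple i hne))

theorem BruhatLE.le_mul_simple {u v : W} (h : cs.BruhatLE u v) (i : B) :
    cs.BruhatLE u (v * cs.simple i) ∨ cs.BruhatLE (u * cs.simple i) (v * cs.simple i) := by
  induction h using Relation.ReflTransGen.head_induction_on with
  | refl => exact Or.inr .refl
  | @head u w hs h ih =>
    rcases ih with ih | ih
    · exact Or.inl (ih.head hs)
    · by_cases hne : w = u * cs.simple i
      · rw [hne] at ih
        exact Or.inl (by simpa using ih)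
      · exact Or.inr (ih.head (hs.mul_simple i hne))

theorem bruhatLE_mul_simple_or (cs : CoxeterSystem M W) (u : W) (i : B) :
    cs.BruhatLE u (u * cs.simple i) ∨ cs.BruhatLE (u * cs.simple i) u := by
  rcases lt_or_gt_of_ne (cs.length_mul_simple_ne u i) with h | h
  · exact Or.inr (.single ⟨cs.simple i, cs.isReflection_simple i, by simp, h⟩)
  · exact Or.inl (.single ⟨cs.simple i, cs.isReflection_simple i, rfl, h⟩)

theorem BruhatLE.antisymm {u v : W} (h : cs.BruhatLE u v) (h' : cs.BruhatLE v u) : u = v := by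
  rcases h.eq_or_length_lt with h | h
  · exact h
  · rcases h'.eq_or_length_lt with h' | h'
    · exact h'.symm
    · exact absurd (h.trans h') (lt_irrefl _)

theorem mul_simple_ne (cs : CoxeterSystem M W) (u : W) (i : B) : u * cs.simple i ≠ u := fun h =>
  cs.length_mul_simple_ne u i (congrArg cs.length h)

theorem not_bruhatLE_iff (u : W) (i : B) :
    ¬ cs.BruhatLE u (u * cs.simple i) ↔ cs.BruhatLE (u * cs.simple i) u :=
  ⟨fun h => (cs.bruhatLE_mul_simple_or u i).resolve_left h,
    fun h h' => cs.mul_simple_ne u i (h.antisymm h')⟩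

theorem BruhatLE.mul_simple_le {u v : W} {i : B} (h : cs.BruhatLE u v)
    (hv : cs.BruhatLE (v * cs.simple i) v) : cs.BruhatLE (u * cs.simple i) v :=
  (h.mul_simple i).elim id fun h => h.trans hv

theorem BruhatLE.mul_simple_mul_simple {u v : W} {i : B} (h : cs.BruhatLE u v)
    (hv : cs.BruhatLE v (v * cs.simple i)) :
    cs.BruhatLE (u * cs.simple i) (v * cs.simple i) :=
  BruhatLE.mul_simple_le (h.trans hv) (by simpa using hv)

theorem BruhatLE.le_of_le_mul_simple {u v : W} {i : B} (h : cs.BruhatLE u (v * cs.simple i))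
    (hu : cs.BruhatLE u (u * cs.simple i)) : cs.BruhatLE u v := by
  rcases h.le_mul_simple i with h | h
  · simpa using h
  · exact hu.trans (show cs.BruhatLE (u * cs.simple i) v by simpa using h)

end CoxeterSystem

/-! ### Coefficients in an Ore extension -/

namespace IsOreExtension

variable {k R S : Type*} [Field k] [Ring R] [Algebra k R] [Ring S] [Algebra k S]
  {ι : R →ₐ[k] S} {x : S} {τ : R ≃ₐ[k] R} {δ : R →ₗ[k] R}

/-- The coefficients of an element of `R[x; τ, δ]` with respect to the basis of powers of `x`. -/
noncomputable def coeffEquiv (h : IsOreExtension ι x τ δ) : S ≃+ (ℕ →₀ R) :=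
  (AddEquiv.ofBijective
    (Finsupp.liftAddHom fun n => (AddMonoidHom.mulRight (x ^ n)).comp (ι : R →+ S))
    h.basis).symm

theorem coeffEquiv_symm_apply (h : IsOreExtension ι x τ δ) (f : ℕ →₀ R) :
    h.coeffEquiv.symm f = f.sum fun n r => ι r * x ^ n := rfl

/-- The coefficient of `x ^ n`. -/
noncomputable def coeff (h : IsOreExtension ι x τ δ) (n : ℕ) : S →+ R :=
  (Finsupp.applyAddHom n).comp (h.coeffEquiv : S →+ (ℕ →₀ R))

variable (h : IsOreExtension ι x τ δ)
include h

theorem coeff_apply (n : ℕ) (s : S) : h.coeff n s = h.coeffEquiv s n := rfl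

theorem ext_coeff {s t : S} (hst : ∀ n, h.coeff n s = h.coeff n t) : s = t :=
  h.coeffEquiv.injective (Finsupp.ext hst)

theorem coeff_monomial (n m : ℕ) (r : R) :
    h.coeff n (ι r * x ^ m) = if n = m then r else 0 := by
  have : ι r * x ^ m = h.coeffEquiv.symm (Finsupp.single m r) := by
    rw [coeffEquiv_symm_apply, Finsupp.sum_single_index (by simp)]
  rw [this, coeff_apply, AddEquiv.apply_symm_apply, Finsupp.single_apply]
  simp only [eq_comm]

theorem coeff_ι (n : ℕ) (r : R) : h.coeff n (ι r) = if n = 0 then r else 0 := by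
  simpa using h.coeff_monomial n 0 r

theorem coeff_x_pow (n m : ℕ) : h.coeff n (x ^ m) = if n = m then 1 else 0 := by
  simpa using h.coeff_monomial n m 1

theorem induction_monomial {p : S → Prop} (s : S) (hmon : ∀ n r, p (ι r * x ^ n))
    (hadd : ∀ s t, p s → p t → p (s + t)) : p s := by
  obtain ⟨f, rfl⟩ := h.coeffEquiv.symm.surjective s
  rw [coeffEquiv_symm_apply]
  exact Finset.sum_induction _ p hadd (by simpa using hmon 0 0) fun n _ => hmon n _

theorem exists_coeff_eq_zero (s : S) : ∃ d, ∀ i, d < i → h.coeff i s = 0 := by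
  induction s using h.induction_monomial with
  | hmon n r => exact ⟨n, fun i hi => by rw [h.coeff_monomial, if_neg hi.ne']⟩
  | hadd s t hs ht =>
    obtain ⟨d, hd⟩ := hs
    obtain ⟨e, he⟩ := ht
    exact ⟨max d e, fun i hi => by
      rw [map_add, hd i (lt_of_le_of_lt (le_max_left _ _) hi),
        he i (lt_of_le_of_lt (le_max_right _ _) hi), add_zero]⟩

theorem coeff_sum_range (f : ℕ → R) (K n : ℕ) :
    h.coeff n (∑ i ∈ Finset.range K, ι (f i) * x ^ i) = if n < K then f n else 0 := by
  simp [map_sum, h.coeff_monomial]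

theorem eq_sum_coeff {s : S} {d : ℕ} (hd : ∀ i, d < i → h.coeff i s = 0) :
    s = ∑ i ∈ Finset.range (d + 1), ι (h.coeff i s) * x ^ i := by
  refine h.ext_coeff fun n => ?_
  rw [h.coeff_sum_range]
  split_ifs with hn
  · rfl
  · exact hd n (by omega)

theorem coeff_ι_mul (n : ℕ) (r : R) (s : S) : h.coeff n (ι r * s) = r * h.coeff n s := by
  induction s using h.induction_monomial with
  | hmon m a => rw [← mul_assoc, ← map_mul, h.coeff_monomial, h.coeff_monomial, mul_ite, mul_zero]
  | hadd s t hs ht => rw [mul_add, map_add, map_add, mul_add, hs, ht]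

theorem coeff_smul (n : ℕ) (c : k) (s : S) : h.coeff n (c • s) = c • h.coeff n s := by
  rw [← smul_one_mul c s, ← map_one ι, ← map_smul, h.coeff_ι_mul, smul_one_mul]

theorem coeff_mul_x_succ (n : ℕ) (s : S) : h.coeff (n + 1) (s * x) = h.coeff n s := by
  induction s using h.induction_monomial with
  | hmon m a => rw [mul_assoc, ← pow_succ, h.coeff_monomial, h.coeff_monomial]; simp
  | hadd s t hs ht => rw [add_mul, map_add, map_add, hs, ht]

theorem coeff_mul_x_zero (s : S) : h.coeff 0 (s * x) = 0 := by
  induction s using h.induction_monomial with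
  | hmon m a => rw [mul_assoc, ← pow_succ, h.coeff_monomial]; simp
  | hadd s t hs ht => rw [add_mul, map_add, hs, ht, add_zero]

theorem coeff_mul_x_pow (n m : ℕ) (s : S) : h.coeff (n + m) (s * x ^ m) = h.coeff n s := by
  induction m with
  | zero => simp
  | succ m ih => rw [pow_succ, ← mul_assoc, ← add_assoc, h.coeff_mul_x_succ, ih]

theorem coeff_mul_x_pow_of_lt {n m : ℕ} (hn : n < m) (s : S) : h.coeff n (s * x ^ m) = 0 := by
  induction m generalizing n with
  | zero => omega
  | succ m ih =>
    rw [pow_succ, ← mul_assoc]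
    cases n with
    | zero => exact h.coeff_mul_x_zero _
    | succ n => rw [h.coeff_mul_x_succ, ih (by omega)]

theorem coeff_x_mul_succ (n : ℕ) (s : S) :
    h.coeff (n + 1) (x * s) = τ (h.coeff n s) + δ (h.coeff (n + 1) s) := by
  induction s using h.induction_monomial with
  | hmon m a =>
    rw [← mul_assoc, h.commute, add_mul, mul_assoc, ← pow_succ', map_add]
    simp only [h.coeff_monomial, Nat.add_right_cancel_iff]
    congr 1 <;> split_ifs <;> simp
  | hadd s t hs ht =>
    rw [mul_add, map_add, map_add, map_add, map_add, map_add, hs, ht]; abel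

theorem coeff_x_mul_zero (s : S) : h.coeff 0 (x * s) = δ (h.coeff 0 s) := by
  induction s using h.induction_monomial with
  | hmon m a =>
    rw [← mul_assoc, h.commute, add_mul, mul_assoc, ← pow_succ', map_add]
    simp only [h.coeff_monomial]
    split_ifs <;> simp_all
  | hadd s t hs ht => rw [mul_add, map_add, map_add, map_add, hs, ht]

theorem coeff_x_pow_mul_top (m : ℕ) {n : ℕ} {t : S} (ht : ∀ i, n < i → h.coeff i t = 0) :
    (∀ i, m + n < i → h.coeff i (x ^ m * t) = 0) ∧
      h.coeff (m + n) (x ^ m * t) = (τ ^ m) (h.coeff n t) := by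
  induction m with
  | zero => simpa using ht
  | succ m ih =>
    constructor
    · rintro (_ | i) hi
      · omega
      · rw [pow_succ', mul_assoc, h.coeff_x_mul_succ, ih.1 i (by omega), ih.1 (i + 1) (by omega)]
        simp
    · rw [add_right_comm, pow_succ', mul_assoc, h.coeff_x_mul_succ, ih.2, ih.1 _ (by omega),
        map_zero, add_zero, pow_succ', AlgEquiv.mul_apply]

/-- The derivation only contributes to lower degrees, so leading terms multiply as in a skew
polynomial ring. The bounds `m` and `n` need not be the exact degrees. -/
theorem coeff_mul_top {m n : ℕ} {s t : S} (hs : ∀ i, m < i → h.coeff i s = 0)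
    (ht : ∀ i, n < i → h.coeff i t = 0) :
    (∀ i, m + n < i → h.coeff i (s * t) = 0) ∧
      h.coeff (m + n) (s * t) = h.coeff m s * (τ ^ m) (h.coeff n t) := by
  have e : ∀ i, h.coeff i (s * t) =
      ∑ j ∈ Finset.range (m + 1), h.coeff j s * h.coeff i (x ^ j * t) := fun i => by
    conv_lhs => rw [h.eq_sum_coeff hs, Finset.sum_mul, map_sum]
    simp only [mul_assoc, h.coeff_ι_mul]
  simp only [e]
  constructor
  · intro i hi
    refine Finset.sum_eq_zero fun j hj => ?_
    rw [(h.coeff_x_pow_mul_top j ht).1 i (by simp at hj; omega), mul_zero]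
  · rw [Finset.sum_range_succ, Finset.sum_eq_zero, zero_add, (h.coeff_x_pow_mul_top m ht).2]
    · intro j hj
      rw [(h.coeff_x_pow_mul_top j ht).1 _ (by simp at hj; omega), mul_zero]

theorem coeff_x_mul_mem {A : TwoSidedIdeal R} (hτ : ∀ a ∈ A, τ a ∈ A) (hδ : ∀ a ∈ A, δ a ∈ A)
    {s : S} (hs : ∀ n, h.coeff n s ∈ A) (n : ℕ) : h.coeff n (x * s) ∈ A := by
  cases n with
  | zero => rw [h.coeff_x_mul_zero]; exact hδ _ (hs 0)
  | succ n => rw [h.coeff_x_mul_succ]; exact A.add_mem (hτ _ (hs n)) (hδ _ (hs _))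

theorem coeff_x_pow_mul_mem {A : TwoSidedIdeal R} (hτ : ∀ a ∈ A, τ a ∈ A)
    (hδ : ∀ a ∈ A, δ a ∈ A) (m : ℕ) {s : S} (hs : ∀ n, h.coeff n s ∈ A) :
    ∀ n, h.coeff n (x ^ m * s) ∈ A := by
  induction m with
  | zero => simpa using hs
  | succ m ih => rw [pow_succ', mul_assoc]; exact h.coeff_x_mul_mem hτ hδ ih

theorem coeff_mul_mem {A B C : TwoSidedIdeal R} (hτ : ∀ b ∈ B, τ b ∈ B) (hδ : ∀ b ∈ B, δ b ∈ B)
    (hAB : ∀ a ∈ A, ∀ b ∈ B, a * b ∈ C) {s t : S} (hs : ∀ n, h.coeff n s ∈ A)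
    (ht : ∀ n, h.coeff n t ∈ B) (n : ℕ) : h.coeff n (s * t) ∈ C := by
  obtain ⟨d, hd⟩ := h.exists_coeff_eq_zero s
  rw [h.eq_sum_coeff hd, Finset.sum_mul, map_sum]
  refine C.finsetSum_mem _ _ fun i _ => ?_
  rw [mul_assoc, h.coeff_ι_mul]
  exact hAB _ (hs i) _ (h.coeff_x_pow_mul_mem hτ hδ i ht n)

/-- The ideal `A[x; τ, δ]` of `R[x; τ, δ]`, for an ideal `A` stable under `τ` and `δ`. -/
noncomputable def coeffIdeal (A : TwoSidedIdeal R) (hτ : ∀ a ∈ A, τ a ∈ A)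
    (hδ : ∀ a ∈ A, δ a ∈ A) : TwoSidedIdeal S :=
  .mk' {s | ∀ n, h.coeff n s ∈ A} (fun n => by simp [A.zero_mem])
    (fun hs ht n => by rw [map_add]; exact A.add_mem (hs n) (ht n))
    (fun hs n => by rw [map_neg]; exact A.neg_mem (hs n))
    (fun {s t} ht n => h.coeff_mul_mem (A := ⊤) (B := A) (C := A) hτ hδ
      (fun a _ b hb => A.mul_mem_left a b hb) (fun _ => TwoSidedIdeal.mem_top _) ht n)
    (fun {s t} hs n => h.coeff_mul_mem (A := A) (B := ⊤) (C := A)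
      (fun _ _ => TwoSidedIdeal.mem_top _) (fun _ _ => TwoSidedIdeal.mem_top _)
      (fun a ha b _ => A.mul_mem_right a b ha) hs (fun _ => TwoSidedIdeal.mem_top _) n)

theorem mem_coeffIdeal {A : TwoSidedIdeal R} {hτ : ∀ a ∈ A, τ a ∈ A} {hδ : ∀ a ∈ A, δ a ∈ A}
    {s : S} : s ∈ h.coeffIdeal A hτ hδ ↔ ∀ n, h.coeff n s ∈ A := by
  simp [coeffIdeal, TwoSidedIdeal.mem_mk']

theorem mem_of_coeff_mem {I : TwoSidedIdeal S} {s : S} (hs : ∀ n, ι (h.coeff n s) ∈ I) :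
    s ∈ I := by
  obtain ⟨d, hd⟩ := h.exists_coeff_eq_zero s
  rw [h.eq_sum_coeff hd]
  exact I.finsetSum_mem _ _ fun i _ => I.mul_mem_right _ _ (hs i)

/-- The twisted leading coefficients of the elements of degree at most `n` of a left ideal. -/
noncomputable def leadIdeal (I : Ideal S) (n : ℕ) : Ideal R where
  carrier := {r | ∃ s ∈ I, (∀ i, n < i → h.coeff i s = 0) ∧ h.coeff n s = (τ ^ n) r}
  zero_mem' := ⟨0, I.zero_mem, by simp, by simp⟩
  add_mem' := by
    rintro a b ⟨s, hs, hs', hsa⟩ ⟨t, ht, ht', htb⟩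
    exact ⟨s + t, I.add_mem hs ht, fun i hi => by rw [map_add, hs' i hi, ht' i hi, add_zero],
      by rw [map_add, map_add, hsa, htb]⟩
  smul_mem' := by
    rintro a b ⟨s, hs, hs', hsa⟩
    exact ⟨ι ((τ ^ n) a) * s, I.mul_mem_left _ hs,
      fun i hi => by rw [h.coeff_ι_mul, hs' i hi, mul_zero],
      by rw [h.coeff_ι_mul, hsa, smul_eq_mul, map_mul]⟩

theorem mem_leadIdeal {I : Ideal S} {n : ℕ} {r : R} : r ∈ h.leadIdeal I n ↔
    ∃ s ∈ I, (∀ i, n < i → h.coeff i s = 0) ∧ h.coeff n s = (τ ^ n) r := Iff.rfl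

theorem leadIdeal_mono {I J : Ideal S} (hIJ : I ≤ J) (n : ℕ) :
    h.leadIdeal I n ≤ h.leadIdeal J n :=
  fun _ ⟨s, hs, hs'⟩ => ⟨s, hIJ hs, hs'⟩

/-- This is the purpose of the twist by `τ ^ n` in `leadIdeal`: left multiplication by `x` applies
`τ` to the leading coefficient, and the twist absorbs it. -/
theorem leadIdeal_monotone (I : Ideal S) : Monotone (h.leadIdeal I) := by
  refine monotone_nat_of_le_succ fun n r hr => ?_
  obtain ⟨s, hs, hs', hsr⟩ := hr
  refine ⟨x * s, I.mul_mem_left _ hs, ?_, ?_⟩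
  · rintro (_ | i) hi
    · omega
    · rw [h.coeff_x_mul_succ, hs' i (by omega), hs' (i + 1) (by omega)]; simp
  · rw [h.coeff_x_mul_succ, hs' (n + 1) (by omega), hsr, map_zero, add_zero, pow_succ',
      AlgEquiv.mul_apply]

theorem le_of_leadIdeal_le {I J : Ideal S} (hIJ : I ≤ J)
    (hle : ∀ n, h.leadIdeal J n ≤ h.leadIdeal I n) : J ≤ I := by
  have key : ∀ d : ℕ, ∀ s ∈ J, (∀ i, d ≤ i → h.coeff i s = 0) → s ∈ I := by
    intro d
    induction d with
    | zero =>
      intro s _ hs'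
      rw [h.ext_coeff (s := s) (t := 0) fun n => by rw [hs' n (Nat.zero_le _), map_zero]]
      exact I.zero_mem
    | succ d ih =>
      intro s hs hs'
      obtain ⟨t, ht, ht', hts⟩ := hle d ((h.mem_leadIdeal (r := (τ ^ d).symm (h.coeff d s))).2
        ⟨s, hs, fun i hi => hs' i hi, by simp⟩)
      rw [AlgEquiv.apply_symm_apply] at hts
      have := ih (s - t) (J.sub_mem hs (hIJ ht)) fun i hi => by
        rcases hi.eq_or_lt with rfl | hi
        · rw [map_sub, hts, sub_self]
        · rw [map_sub, ht' i hi, hs' i hi, sub_zero]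
      simpa using I.add_mem this ht
  intro s hs
  obtain ⟨d, hd⟩ := h.exists_coeff_eq_zero s
  exact key (d + 1) s hs fun i hi => hd i hi

/-- The Hilbert basis theorem for Ore extensions. -/
theorem isNoetherianRing [IsNoetherianRing R] : IsNoetherianRing S := by
  refine monotone_stabilizes_iff_noetherian.1 fun f => ?_
  have stab := fun g => monotone_stabilizes_iff_noetherian.2 (inferInstance : IsNoetherian R R) g
  have hmono : ∀ {m n i j : ℕ}, m ≤ n → i ≤ j → h.leadIdeal (f m) i ≤ h.leadIdeal (f n) j :=
    fun hmn hij => (h.leadIdeal_mono (f.monotone hmn) _).trans (h.leadIdeal_monotone _ hij)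
  -- The diagonal chain controls all degrees `i ≥ N` at once; the finitely many degrees below `N`
  -- are stabilized one at a time.
  obtain ⟨N, hN⟩ := stab ⟨fun n => h.leadIdeal (f n) n, fun m n hmn => hmono hmn hmn⟩
  choose K hK using fun i => stab ⟨fun n => h.leadIdeal (f n) i, fun m n hmn => hmono hmn le_rfl⟩
  refine ⟨max N ((Finset.range N).sup K), fun m hm => (f.monotone hm).antisymm ?_⟩
  refine h.le_of_leadIdeal_le (f.monotone hm) fun i => ?_
  rcases lt_or_ge i N with hi | hi
  · have hKi : K i ≤ max N ((Finset.range N).sup K) :=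
      (Finset.le_sup (f := K) (Finset.mem_range.2 hi)).trans (le_max_right _ _)
    have e1 := hK i _ hKi
    have e2 := hK i _ (hKi.trans hm)
    exact (e2.symm.trans e1).le
  · have e := hN (max m i) ((le_max_left _ _).trans (hm.trans (le_max_left _ _)))
    calc h.leadIdeal (f m) i ≤ h.leadIdeal (f (max m i)) (max m i) :=
          hmono (le_max_left _ _) (le_max_right _ _)
      _ = h.leadIdeal (f N) N := e.symm
      _ ≤ _ := hmono (le_max_left _ _) hi

end IsOreExtension

/-! ### Homogeneous elements of a Cauchon extension -/

theorem TwoSidedIdeal.algebra_smul_mem {k R : Type*} [Field k] [Ring R] [Algebra k R]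
    (I : TwoSidedIdeal R) (c : k) {r : R} (hr : r ∈ I) : c • r ∈ I := by
  rw [← smul_one_mul]; exact I.mul_mem_left _ _ hr

theorem TwoSidedIdeal.isStable_top (H : Type*) {A : Type*} [Ring A] [Group H]
    [MulSemiringAction H A] : (⊤ : TwoSidedIdeal A).IsStable H :=
  fun _ _ _ => TwoSidedIdeal.mem_top _

theorem TwoSidedIdeal.IsCompletelyPrime.isHPrime {H A : Type*} [Ring A] [Group H]
    [MulSemiringAction H A] {P : TwoSidedIdeal A} (hP : P.IsCompletelyPrime)
    (hs : P.IsStable H) : P.IsHPrime H where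
  ne_top := hP.ne_top
  stable := hs
  le_or_le I J _ _ hIJ := by
    by_contra! hne
    obtain ⟨a, ha, ha'⟩ := Set.not_subset.1 hne.1
    obtain ⟨b, hb, hb'⟩ := Set.not_subset.1 hne.2
    exact (hP.mem_or_mem a b (hIJ a ha b hb)).elim ha' hb'

/-- For `H`-prime ideals, primeness may be tested on an element and an eigenvector. -/
theorem TwoSidedIdeal.IsHPrime.mem_or_mem_of_eigenvector {k H A : Type*} [Field k] [Ring A]
    [Algebra k A] [Group H] [MulSemiringAction H A] {P : TwoSidedIdeal A} (hP : P.IsHPrime H)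
    {a b : A} (hb : ∀ g : H, ∃ c : k, g • b = c • b) (hab : ∀ s, a * s * b ∈ P) :
    a ∈ P ∨ b ∈ P := by
  let I : TwoSidedIdeal A := .mk' {a | ∀ s, a * s * b ∈ P} (fun s => by simp [P.zero_mem])
    (fun {a a'} ha ha' s => by rw [add_mul, add_mul]; exact P.add_mem (ha s) (ha' s))
    (fun {a} ha s => by rw [neg_mul, neg_mul]; exact P.neg_mem (ha s))
    (fun {y a} ha s => by rw [mul_assoc y, mul_assoc y]; exact P.mul_mem_left _ _ (ha s))
    (fun {a y} ha s => by rw [mul_assoc a]; exact ha _)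
  let J : TwoSidedIdeal A := .mk' {b | ∀ a ∈ I, a * b ∈ P} (fun a _ => by simp [P.zero_mem])
    (fun {b b'} hb hb' a ha => by rw [mul_add]; exact P.add_mem (hb a ha) (hb' a ha))
    (fun {b} hb a ha => by rw [mul_neg]; exact P.neg_mem (hb a ha))
    (fun {y b} hb a ha => by rw [← mul_assoc]; exact hb _ (I.mul_mem_right _ _ ha))
    (fun {b y} hb a ha => by rw [← mul_assoc]; exact P.mul_mem_right _ _ (hb a ha))
  have hI : ∀ a, a ∈ I ↔ ∀ s, a * s * b ∈ P := fun a => by simp [I, TwoSidedIdeal.mem_mk']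
  have hJ : ∀ b, b ∈ J ↔ ∀ a ∈ I, a * b ∈ P := fun b => by simp [J, TwoSidedIdeal.mem_mk']
  -- The eigenvalue is taken for `g⁻¹` and the result is moved back by `g`, so no scalar has to be
  -- inverted.
  have hIs : I.IsStable H := by
    intro g a ha
    rw [hI] at ha ⊢
    intro s
    obtain ⟨c, hc⟩ := hb g⁻¹
    have := P.algebra_smul_mem c (ha (g⁻¹ • s))
    rw [← mul_smul_comm, ← hc] at this
    simpa using hP.stable g _ this
  have hJs : J.IsStable H := by
    intro g b hb
    rw [hJ] at hb ⊢
    intro a ha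
    simpa using hP.stable g _ (hb _ (hIs g⁻¹ a ha))
  rcases hP.le_or_le I J hIs hJs fun a ha b hb => (hJ b).1 hb a ha with hle | hle
  · exact Or.inl (hle ((hI a).2 hab))
  · exact Or.inr (hle ((hJ b).2 fun a ha => by simpa using (hI a).1 ha 1))

theorem Module.End.pow_apply_eq_zero_of_le {k M : Type*} [Semiring k] [AddCommMonoid M]
    [Module k M] {f : Module.End k M} {m n : ℕ} (hmn : m ≤ n) {r : M} (hr : (f ^ m) r = 0) :
    (f ^ n) r = 0 := by
  rw [← Nat.sub_add_cancel hmn, pow_add, Module.End.mul_apply, hr, map_zero]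

namespace IsCauchonExtension

variable {H k R S : Type*} [Field k] [Ring R] [Algebra k R]
  [Ring S] [Algebra k S] [CommGroup H] [MulSemiringAction H R] [MulSemiringAction H S]
  {ι : R →ₐ[k] S} {x : S} {τ : R ≃ₐ[k] R} {δ : R →ₗ[k] R} {q : kˣ}

/-- The element of `H` that acts on `R` as `τ`. -/
noncomputable def twist (h : IsCauchonExtension H ι x τ δ q) : H := h.exists_h₀.choose

/-- The eigenvalue of `x` for `twist`. -/
noncomputable def eigenvalue (h : IsCauchonExtension H ι x τ δ q) : k :=
  h.exists_h₀.choose_spec.2.choose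

section

variable (h : IsCauchonExtension H ι x τ δ q)
include h

theorem twist_smul (r : R) : h.twist • r = τ r := h.exists_h₀.choose_spec.1 r

theorem twist_smul_x : h.twist • x = h.eigenvalue • x :=
  h.exists_h₀.choose_spec.2.choose_spec.1

theorem eigenvalue_pow_ne_one {n : ℕ} (hn : 0 < n) : h.eigenvalue ^ n ≠ 1 :=
  h.exists_h₀.choose_spec.2.choose_spec.2 n hn

theorem twist_inv_smul (r : R) : h.twist⁻¹ • r = τ.symm r := by
  rw [inv_smul_eq_iff, h.twist_smul, AlgEquiv.apply_symm_apply]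

theorem coeff_group_smul {g : H} {γ : k} (hg : g • x = γ • x) (n : ℕ) (s : S) :
    h.coeff n (g • s) = γ ^ n • (g • h.coeff n s) := by
  induction s using h.induction_monomial with
  | hmon m r =>
    rw [smul_mul', smul_pow', hg, smul_pow, h.equivariant, mul_smul_comm, h.coeff_smul,
      h.coeff_monomial, h.coeff_monomial]
    split_ifs with hnm
    · rw [hnm]
    · simp
  | hadd s t hs ht => rw [smul_add, map_add, map_add, smul_add, smul_add, hs, ht]

theorem coeff_twist_smul (n : ℕ) (s : S) :
    h.coeff n (h.twist • s) = h.eigenvalue ^ n • τ (h.coeff n s) := by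
  rw [h.coeff_group_smul h.twist_smul_x, h.twist_smul]

theorem group_eigenvalue_ne_zero [Nontrivial R] {g : H} {γ : k} (hg : g • x = γ • x) : γ ≠ 0 := by
  rintro rfl
  rw [zero_smul, smul_eq_zero_iff_eq] at hg
  have := h.coeff_x_pow 1 1
  simp [hg] at this

theorem eigenvalue_ne_zero [Nontrivial R] : h.eigenvalue ≠ 0 :=
  h.group_eigenvalue_ne_zero h.twist_smul_x

theorem eigenvalue_pow_injective [Nontrivial R] {m n : ℕ}
    (hmn : h.eigenvalue ^ m = h.eigenvalue ^ n) : m = n := by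
  have key : ∀ {a b : ℕ}, h.eigenvalue ^ a = h.eigenvalue ^ b → ¬ a < b := fun {a b} hab hlt => by
    refine h.eigenvalue_pow_ne_one (Nat.sub_pos_of_lt hlt)
      (mul_left_cancel₀ (pow_ne_zero a h.eigenvalue_ne_zero) ?_)
    rw [← pow_add, Nat.add_sub_cancel' hlt.le, mul_one, hab]
  exact le_antisymm (not_lt.1 (key hmn.symm)) (not_lt.1 (key hmn))

/-- Apply `twist` to `x r = τ(r) x + δ(r)` and compare constant terms. The eigenvalue is thus `q⁻¹`
unless `δ = 0`, and this form covers both cases. -/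
theorem eigenvalue_smul_δ (r : R) : h.eigenvalue • (q : k) • δ r = δ r := by
  have e := congrArg (fun s => h.coeff 0 (h.twist • s)) (h.commute r)
  simp only [smul_mul', smul_add, h.twist_smul_x, h.equivariant, h.twist_smul, map_add,
    smul_mul_assoc, mul_smul_comm, h.coeff_smul, h.coeff_x_mul_zero, h.coeff_mul_x_zero,
    h.coeff_ι, if_true, h.q_commute, smul_zero, zero_add] at e
  apply τ.injective
  rw [map_smul, map_smul, e]

theorem eigenvalue_pow_smul_δ (l : ℕ) (r : R) :
    h.eigenvalue ^ l • (q : k) ^ l • δ r = δ r := by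
  induction l with
  | zero => simp
  | succ l ih =>
    rw [pow_succ', pow_succ', mul_smul, mul_smul, smul_comm (h.eigenvalue ^ l), ih,
      h.eigenvalue_smul_δ]

theorem δ_pow_τ (n : ℕ) (r : R) : (δ ^ n) (τ r) = (q : k) ^ n • τ ((δ ^ n) r) := by
  induction n with
  | zero => simp
  | succ n ih =>
    rw [pow_succ', Module.End.mul_apply, ih, map_smul, h.q_commute, Module.End.mul_apply,
      smul_smul, pow_succ]

theorem δ_pow_τ_eq_zero {n : ℕ} {r : R} (hr : (δ ^ n) r = 0) : (δ ^ n) (τ r) = 0 := by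
  rw [h.δ_pow_τ, hr, map_zero, smul_zero]

theorem δ_pow_τ_symm_eq_zero {n : ℕ} {r : R} (hr : (δ ^ n) r = 0) : (δ ^ n) (τ.symm r) = 0 := by
  have := h.δ_pow_τ n (τ.symm r)
  rw [AlgEquiv.apply_symm_apply, hr, eq_comm, smul_eq_zero] at this
  simpa using this

theorem δ_pow_τ_symm_iterate_eq_zero {n : ℕ} {r : R} (hr : (δ ^ n) r = 0) (l : ℕ) :
    (δ ^ n) (τ.symm^[l] r) = 0 := by
  induction l with
  | zero => exact hr
  | succ l ih => rw [Function.iterate_succ_apply']; exact h.δ_pow_τ_symm_eq_zero ih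

theorem τ_mem {A : TwoSidedIdeal R} (hA : A.IsStable H) {a : R} (ha : a ∈ A) : τ a ∈ A := by
  rw [← h.twist_smul]; exact hA _ _ ha

theorem τ_symm_mem {A : TwoSidedIdeal R} (hA : A.IsStable H) {a : R} (ha : a ∈ A) :
    τ.symm a ∈ A := by
  rw [← h.twist_inv_smul]; exact hA _ _ ha

theorem τ_pow_mem {A : TwoSidedIdeal R} (hA : A.IsStable H) {a : R} (ha : a ∈ A) (m : ℕ) :
    (τ ^ m) a ∈ A := by
  induction m with
  | zero => exact ha
  | succ m ih => rw [pow_succ', AlgEquiv.mul_apply]; exact h.τ_mem hA ih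

theorem mem_of_τ_mem {A : TwoSidedIdeal R} (hA : A.IsStable H) {a : R} (ha : τ a ∈ A) :
    a ∈ A := by
  simpa using h.τ_symm_mem hA ha

theorem mem_of_τ_pow_mem {A : TwoSidedIdeal R} (hA : A.IsStable H) {m : ℕ} {a : R}
    (ha : (τ ^ m) a ∈ A) : a ∈ A := by
  induction m with
  | zero => exact ha
  | succ m ih => rw [pow_succ', AlgEquiv.mul_apply] at ha; exact ih (h.mem_of_τ_mem hA ha)

theorem τ_symm_iterate_mem {A : TwoSidedIdeal R} (hA : A.IsStable H) {a : R} (ha : a ∈ A)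
    (l : ℕ) : τ.symm^[l] a ∈ A := by
  induction l with
  | zero => exact ha
  | succ l ih => rw [Function.iterate_succ_apply']; exact h.τ_symm_mem hA ih

end

/-- `s` commutes with `x` up to the action of `twist` and the `p`-th power of the eigenvalue. These
are the elements `C(r) x ^ p` of `R[x; τ, δ]`. -/
def IsHomog (h : IsCauchonExtension H ι x τ δ q) (p : ℕ) (s : S) : Prop :=
  h.eigenvalue ^ p • (x * s) = (h.twist • s) * x

section

variable {h : IsCauchonExtension H ι x τ δ q}

theorem IsHomog.mul {p p' : ℕ} {s t : S} (hs : h.IsHomog p s) (ht : h.IsHomog p' t) :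
    h.IsHomog (p + p') (s * t) := by
  unfold IsHomog at *
  rw [smul_mul', mul_assoc (h.twist • s), ← ht, mul_smul_comm, ← mul_assoc (h.twist • s), ← hs,
    smul_mul_assoc, smul_smul, pow_add, mul_comm, mul_assoc]

theorem IsHomog.smul {p : ℕ} {s : S} (hs : h.IsHomog p s) (c : k) : h.IsHomog p (c • s) := by
  unfold IsHomog at *
  rw [mul_smul_comm, smul_comm, hs, h.smul_scalar, smul_mul_assoc c]

theorem IsHomog.neg {p : ℕ} {s : S} (hs : h.IsHomog p s) : h.IsHomog p (-s) := by
  simpa using hs.smul (-1)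

theorem IsHomog.add {p : ℕ} {s t : S} (hs : h.IsHomog p s) (ht : h.IsHomog p t) :
    h.IsHomog p (s + t) := by
  unfold IsHomog at *
  rw [mul_add, smul_add, hs, ht, smul_add, add_mul]

theorem isHomog_zero (p : ℕ) : h.IsHomog p 0 := by simp [IsHomog]

theorem isHomog_x_pow (p : ℕ) : h.IsHomog p (x ^ p) := by
  rw [IsHomog, smul_pow', h.twist_smul_x, smul_pow, smul_mul_assoc, ← pow_succ, ← pow_succ']

/-- Commutativity of `H` makes `g` commute with `twist`, and the eigenvalue of `g` on `x` cancels
from both sides. -/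
theorem IsHomog.group_smul [Nontrivial R] {p : ℕ} {s : S} (hs : h.IsHomog p s) (g : H) :
    h.IsHomog p (g • s) := by
  unfold IsHomog at *
  obtain ⟨γ, hγ⟩ := h.eigenvector g
  have := congrArg (g • ·) hs
  simp only [smul_mul', h.smul_scalar, hγ, mul_smul_comm, smul_mul_assoc] at this
  rw [smul_comm] at this
  rw [smul_right_injective S (h.group_eigenvalue_ne_zero hγ) this, smul_smul, smul_smul, mul_comm]

theorem IsHomog.coeff_zero [Nontrivial R] {p : ℕ} {s : S} (hs : h.IsHomog p s) :
    δ (h.coeff 0 s) = 0 := by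
  have := congrArg (h.coeff 0) hs
  rw [h.coeff_smul, h.coeff_x_mul_zero, h.coeff_mul_x_zero, smul_eq_zero] at this
  exact this.resolve_left (pow_ne_zero _ h.eigenvalue_ne_zero)

/-- For `i ≠ p` the scalar on the right is nonzero, so each coefficient is determined by the one
above it. The recursion breaks only at `i = p`, and this makes `coeff p` a free parameter that
determines the element. -/
theorem IsHomog.coeff_succ {p : ℕ} {s : S} (hs : h.IsHomog p s) (i : ℕ) :
    h.eigenvalue ^ p • δ (h.coeff (i + 1) s) =
      (h.eigenvalue ^ i - h.eigenvalue ^ p) • τ (h.coeff i s) := by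
  have := congrArg (h.coeff (i + 1)) hs
  rw [h.coeff_smul, h.coeff_x_mul_succ, h.coeff_mul_x_succ, h.coeff_twist_smul, smul_add] at this
  rw [sub_smul, ← this, add_sub_cancel_left]

theorem IsHomog.coeff_eq_zero_of_succ [Nontrivial R] {p : ℕ} {s : S} (hs : h.IsHomog p s) {i : ℕ}
    (hi : i ≠ p) (h0 : h.coeff (i + 1) s = 0) : h.coeff i s = 0 := by
  have := hs.coeff_succ i
  rw [h0, map_zero, smul_zero, eq_comm, smul_eq_zero, sub_eq_zero] at this
  exact τ.injective (by
    rw [this.resolve_left fun e => hi (h.eigenvalue_pow_injective e), map_zero])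

/-- The coefficients vanish for large indices, and the recursion carries this vanishing downwards
until it stops at `p`. -/
theorem IsHomog.coeff_eq_zero [Nontrivial R] {p : ℕ} {s : S} (hs : h.IsHomog p s) {i : ℕ}
    (hi : p < i) : h.coeff i s = 0 := by
  obtain ⟨d, hd⟩ := h.exists_coeff_eq_zero s
  by_cases hid : d < i
  · exact hd i hid
  · have : i ≤ d + 1 := by omega
    induction this using Nat.decreasingInduction with
    | self => exact hd _ (by omega)
    | of_succ j hj ih =>
      rcases lt_or_ge d (j + 1) with hj' | hj'
      · exact hs.coeff_eq_zero_of_succ hi.ne' (hd _ hj')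
      · exact hs.coeff_eq_zero_of_succ hi.ne' (ih (by omega) (by omega))

theorem IsHomog.eq_zero [Nontrivial R] {p : ℕ} {s : S} (hs : h.IsHomog p s)
    (h0 : h.coeff p s = 0) : s = 0 := by
  refine h.ext_coeff fun i => ?_
  rw [map_zero]
  rcases lt_or_ge p i with hi | hi
  · exact hs.coeff_eq_zero hi
  · induction hi using Nat.decreasingInduction with
    | self => exact h0
    | of_succ j hj ih => exact hs.coeff_eq_zero_of_succ (by omega) ih

theorem IsHomog.δ_pow_coeff [Nontrivial R] {p : ℕ} {s : S} (hs : h.IsHomog p s) (i : ℕ) :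
    (δ ^ (i + 1)) (h.coeff i s) = 0 := by
  induction i with
  | zero => simpa using hs.coeff_zero
  | succ i ih =>
    have := congrArg (δ ^ (i + 1)) (hs.coeff_succ i)
    rw [map_smul, map_smul, h.δ_pow_τ_eq_zero ih, smul_zero, smul_eq_zero] at this
    rw [pow_succ, Module.End.mul_apply]
    exact this.resolve_left (pow_ne_zero _ h.eigenvalue_ne_zero)

end

/-- The element `C(r) x ^ p` of `R[x; τ, δ]`. -/
noncomputable def homogLift (_h : IsCauchonExtension H ι x τ δ q) (p : ℕ) (r : R) : S :=
  ∑ i ∈ Finset.range (p + 1),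
    ι (cauchonCoeff (q : k) (p - i) • (δ ^ (p - i)) (τ.symm^[p - i] r)) * x ^ i

/-! ### Homogeneous elements with a prescribed leading coefficient. -/

section

variable (h : IsCauchonExtension H ι x τ δ q)
include h

theorem geom_sum_q_ne_zero (n : ℕ) : ∑ i ∈ Finset.range (n + 1), (q : k) ^ i ≠ 0 := by
  intro h0
  have := geom_sum_mul (q : k) (n + 1)
  rw [h0, zero_mul, eq_comm, sub_eq_zero] at this
  exact h.q_not_root _ n.succ_pos this

theorem cauchonCoeff_succ (l : ℕ) :
    cauchonCoeff (q : k) (l + 1) * ((q : k) ^ (l + 1) - 1) =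
      cauchonCoeff (q : k) l * (q : k) ^ (l + 1) := by
  have hq1 : (q : k) - 1 ≠ 0 := sub_ne_zero.2 (by simpa using h.q_not_root 1 one_pos)
  have hf : ∀ n, qFactorial (q : k) n ≠ 0 := fun n =>
    Finset.prod_ne_zero_iff.2 fun i _ => h.geom_sum_q_ne_zero i
  have e1 : qFactorial (q : k) (l + 1) * ((q : k) - 1) =
      qFactorial (q : k) l * ((q : k) ^ (l + 1) - 1) := by
    rw [qFactorial, Finset.prod_range_succ, mul_assoc, geom_sum_mul]; rfl
  have e2 : (l + 1) * (l + 1 + 1) / 2 = l * (l + 1) / 2 + (l + 1) := by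
    rw [show (l + 1) * (l + 1 + 1) = l * (l + 1) + (l + 1) * 2 by ring,
      Nat.add_mul_div_right _ _ two_pos]
  have e3 : ((q : k) ^ (l + 1) - 1) = qFactorial (q : k) (l + 1) * ((q : k) - 1) /
      qFactorial (q : k) l := by
    rw [e1, mul_div_cancel_left₀ _ (hf l)]
  have h1 := hf l
  have h2 := hf (l + 1)
  rw [e3, cauchonCoeff, cauchonCoeff, e2, pow_add, pow_succ ((q : k) - 1)]
  field_simp

theorem coeff_homogLift (p i : ℕ) (r : R) : h.coeff i (h.homogLift p r) =
    if i < p + 1 then cauchonCoeff (q : k) (p - i) • (δ ^ (p - i)) (τ.symm^[p - i] r) else 0 := by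
  rw [homogLift, h.coeff_sum_range]

theorem coeff_homogLift_self (p : ℕ) (r : R) : h.coeff p (h.homogLift p r) = r := by
  rw [coeff_homogLift]; simp [cauchonCoeff, qFactorial]

/-- The nilpotency assumption says that the series `C(r)` stops at `x ^ (-p)`, so that truncating it
at the constant term loses nothing. The relation in the remaining degrees is the recursion
`cauchonCoeff_succ`, once the eigenvalue has been replaced by `q⁻¹` on the image of `δ`. -/
theorem isHomog_homogLift {p : ℕ} {r : R} (hr : (δ ^ (p + 1)) r = 0) :
    h.IsHomog p (h.homogLift p r) := by
  refine h.ext_coeff fun i => ?_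
  rw [h.coeff_smul]
  cases i with
  | zero =>
    rw [h.coeff_x_mul_zero, h.coeff_mul_x_zero, coeff_homogLift, if_pos p.succ_pos, map_smul,
      ← Module.End.mul_apply, ← pow_succ', Nat.sub_zero, h.δ_pow_τ_symm_iterate_eq_zero hr,
      smul_zero, smul_zero]
  | succ i =>
    rw [h.coeff_x_mul_succ, h.coeff_mul_x_succ, h.coeff_twist_smul, coeff_homogLift,
      coeff_homogLift]
    rcases lt_trichotomy i p with hi | rfl | hi
    · obtain ⟨l, rfl⟩ := Nat.exists_eq_add_of_lt hi
      rw [if_pos (by omega), if_pos (by omega), show i + l + 1 - i = l + 1 by omega,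
        show i + l + 1 - (i + 1) = l by omega]
      set y := τ.symm^[l] r
      have hy : τ.symm^[l + 1] r = τ.symm y := Function.iterate_succ_apply' _ _ _
      have e1 : τ ((δ ^ (l + 1)) (τ.symm y)) = ((q : k) ^ (l + 1))⁻¹ • (δ ^ (l + 1)) y := by
        have := h.δ_pow_τ (l + 1) (τ.symm y)
        rw [AlgEquiv.apply_symm_apply] at this
        rw [this, inv_smul_smul₀ (pow_ne_zero _ q.ne_zero)]
      have e2 : h.eigenvalue ^ (l + 1) • (δ ^ (l + 1)) y =
          ((q : k) ^ (l + 1))⁻¹ • (δ ^ (l + 1)) y := by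
        have := h.eigenvalue_pow_smul_δ (l + 1) ((δ ^ l) y)
        rw [← Module.End.mul_apply, ← pow_succ', smul_comm] at this
        rw [eq_inv_smul_iff₀ (pow_ne_zero _ q.ne_zero), this]
      rw [hy, map_smul, map_smul, e1, ← Module.End.mul_apply, ← pow_succ', smul_smul, ← add_smul,
        add_assoc i, pow_add, mul_smul, smul_comm (h.eigenvalue ^ (l + 1)), e2, smul_smul,
        smul_smul, smul_smul]
      congr 1
      have := h.cauchonCoeff_succ l
      have hq := pow_ne_zero (l + 1) q.ne_zero
      field_simp
      linear_combination -h.eigenvalue ^ i * this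
    · rw [if_pos (by omega), if_neg (by omega), map_zero, add_zero]
    · rw [if_neg (by omega), if_neg (by omega)]; simp

theorem IsHomog.eq_homogLift [Nontrivial R] {p : ℕ} {s : S} (hs : h.IsHomog p s) :
    s = h.homogLift p (h.coeff p s) := by
  have h1 : h.IsHomog p (s + -h.homogLift p (h.coeff p s)) :=
    hs.add (h.isHomog_homogLift (hs.δ_pow_coeff p)).neg
  have := h1.eq_zero (by rw [map_add, map_neg, coeff_homogLift_self, add_neg_cancel])
  rwa [add_neg_eq_zero] at this

theorem coeff_homogLift_mem {A : TwoSidedIdeal R} (hA : A.IsStable H) (hδ : ∀ a ∈ A, δ a ∈ A)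
    {r : R} (hr : r ∈ A) (p i : ℕ) : h.coeff i (h.homogLift p r) ∈ A := by
  have key : ∀ n, ∀ a ∈ A, (δ ^ n) a ∈ A := fun n => by
    induction n with
    | zero => simp
    | succ n ih => exact fun a ha => by rw [pow_succ, Module.End.mul_apply]; exact ih _ (hδ _ ha)
  rw [coeff_homogLift]
  split_ifs
  · exact A.algebra_smul_mem _ (key _ _ (h.τ_symm_iterate_mem hA hr _))
  · exact A.zero_mem

end

end IsCauchonExtension

/-! ### Graded subgroups and the ideals they define -/

namespace IsCauchonExtension

variable {H k R S : Type*} [Field k] [Ring R] [Algebra k R]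
  [Ring S] [Algebra k S] [CommGroup H] [MulSemiringAction H R] [MulSemiringAction H S]
  {ι : R →ₐ[k] S} {x : S} {τ : R ≃ₐ[k] R} {δ : R →ₗ[k] R} {q : kˣ}

/-- The sums of homogeneous elements with leading coefficients in `N`. -/
def homogSpan (h : IsCauchonExtension H ι x τ δ q) (N : TwoSidedIdeal R) : AddSubgroup S :=
  AddSubgroup.closure {w | ∃ p, h.IsHomog p w ∧ h.coeff p w ∈ N}

section

variable (h : IsCauchonExtension H ι x τ δ q)
include h

theorem homogSpan_mono {A B : TwoSidedIdeal R} (hAB : A ≤ B) : h.homogSpan A ≤ h.homogSpan B :=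
  AddSubgroup.closure_mono fun _ ⟨p, hw, hp⟩ => ⟨p, hw, hAB hp⟩

theorem homogSpan_le_top (N : TwoSidedIdeal R) : h.homogSpan N ≤ h.homogSpan ⊤ :=
  h.homogSpan_mono fun _ _ => TwoSidedIdeal.mem_top _

theorem mem_homogSpan {N : TwoSidedIdeal R} {p : ℕ} {w : S} (hw : h.IsHomog p w)
    (hp : h.coeff p w ∈ N) : w ∈ h.homogSpan N :=
  AddSubgroup.subset_closure ⟨p, hw, hp⟩

/-- Allowing every sufficiently large range lets two decompositions be added over a common range. -/
theorem exists_homog_decomposition {N : TwoSidedIdeal R} {s : S} (hs : s ∈ h.homogSpan N) :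
    ∃ f : ℕ → S, (∀ p, h.IsHomog p (f p) ∧ h.coeff p (f p) ∈ N) ∧
      ∃ K₀, ∀ K, K₀ ≤ K → s = ∑ p ∈ Finset.range K, f p := by
  induction hs using AddSubgroup.closure_induction with
  | mem w hw =>
    obtain ⟨p, hw, hp⟩ := hw
    refine ⟨Pi.single p w, fun n => ?_, p + 1, fun K hK => ?_⟩
    · by_cases hn : n = p
      · subst hn; simpa using ⟨hw, hp⟩
      · rw [Pi.single_eq_of_ne hn]; exact ⟨isHomog_zero n, by rw [map_zero]; exact N.zero_mem⟩
    · rw [Finset.sum_eq_single p (fun b _ hb => by simp [hb])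
        (fun hb => absurd (Finset.mem_range.2 (by omega)) hb), Pi.single_eq_same]
  | zero => exact ⟨0, fun p => ⟨isHomog_zero p, by
      rw [Pi.zero_apply, map_zero]; exact N.zero_mem⟩, 0, by simp⟩
  | add s t _ _ hs ht =>
    obtain ⟨f, hf, K, hK⟩ := hs
    obtain ⟨g, hg, K', hK'⟩ := ht
    refine ⟨f + g, fun p => ⟨(hf p).1.add (hg p).1, ?_⟩, max K K', fun n hn => ?_⟩
    · rw [Pi.add_apply, map_add]; exact N.add_mem (hf p).2 (hg p).2
    · simp only [Pi.add_apply]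
      rw [Finset.sum_add_distrib, ← hK n (by omega), ← hK' n (by omega)]
  | neg s _ hs =>
    obtain ⟨f, hf, K, hK⟩ := hs
    refine ⟨-f, fun p => ⟨(hf p).1.neg, ?_⟩, K, fun n hn => ?_⟩
    · rw [Pi.neg_apply, map_neg]; exact N.neg_mem (hf p).2
    · simp only [Pi.neg_apply]
      rw [Finset.sum_neg_distrib, ← hK n hn]

theorem exists_homog_sum {N : TwoSidedIdeal R} {s : S} (hs : s ∈ h.homogSpan N) :
    ∃ (f : ℕ → S) (K : ℕ), (∀ p, h.IsHomog p (f p) ∧ h.coeff p (f p) ∈ N) ∧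
      s = ∑ p ∈ Finset.range K, f p := by
  obtain ⟨f, hf, K, hK⟩ := h.exists_homog_decomposition hs
  exact ⟨f, K, hf, hK K le_rfl⟩

/-- A component of index `p` has degree exactly `p` unless it is zero, so different components
cannot cancel at the top. If `d` exceeds the degree, the coefficient is `0`. -/
theorem coeff_top_mem [Nontrivial R] {N : TwoSidedIdeal R} {s : S} (hs : s ∈ h.homogSpan N)
    {d : ℕ} (hd : ∀ i, d < i → h.coeff i s = 0) : h.coeff d s ∈ N := by
  obtain ⟨f, K, hf, rfl⟩ := h.exists_homog_sum hs
  clear hs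
  induction K with
  | zero => simp [N.zero_mem]
  | succ K ih =>
    have hlt : ∀ j, K ≤ j → h.coeff j (∑ p ∈ Finset.range K, f p) = 0 := fun j hj => by
      rw [map_sum]
      exact Finset.sum_eq_zero fun p hp =>
        (hf p).1.coeff_eq_zero ((Finset.mem_range.1 hp).trans_le hj)
    rw [Finset.sum_range_succ] at hd ⊢
    rcases lt_trichotomy d K with hdK | rfl | hdK
    · have h0 : f K = 0 := (hf K).1.eq_zero (by
        have := hd K hdK
        rwa [map_add, hlt K le_rfl, zero_add] at this)
      rw [h0, add_zero] at hd ⊢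
      exact ih hd
    · rw [map_add, hlt d le_rfl, zero_add]
      exact (hf d).2
    · rw [map_add, hlt d hdK.le, zero_add, (hf K).1.coeff_eq_zero hdK]
      exact N.zero_mem

/-- Subtract the homogeneous lift of the top coefficient and induct on the degree. The nilpotency
condition makes the lift homogeneous, and both hypotheses survive the subtraction. -/
theorem mem_homogSpan_of_coeff [Nontrivial R] {A : TwoSidedIdeal R} (hA : A.IsStable H)
    (hδ : ∀ a ∈ A, δ a ∈ A) {s : S} (hs : ∀ i, h.coeff i s ∈ A)
    (hs' : ∀ i, (δ ^ (i + 1)) (h.coeff i s) = 0) : s ∈ h.homogSpan A := by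
  have key : ∀ d : ℕ, ∀ s : S, (∀ i, h.coeff i s ∈ A) → (∀ i, (δ ^ (i + 1)) (h.coeff i s) = 0) →
      (∀ i, d ≤ i → h.coeff i s = 0) → s ∈ h.homogSpan A := by
    intro d
    induction d with
    | zero =>
      intro s _ _ hd
      rw [h.ext_coeff (s := s) (t := 0) fun n => by rw [hd n n.zero_le, map_zero]]
      exact zero_mem _
    | succ d ih =>
      intro s hs hs' hd
      have hw := h.isHomog_homogLift (hs' d)
      have hlead := h.coeff_homogLift_self d (h.coeff d s)
      have hmem := ih (s - h.homogLift d (h.coeff d s))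
        (fun i => by
          rw [map_sub]; exact A.sub_mem (hs i) (h.coeff_homogLift_mem hA hδ (hs d) d i))
        (fun i => by rw [map_sub, map_sub, hs', hw.δ_pow_coeff, sub_zero])
        (fun i hi => by
          rcases hi.eq_or_lt with rfl | hi
          · rw [map_sub, hlead, sub_self]
          · rw [map_sub, hw.coeff_eq_zero hi, hd i hi, sub_zero])
      have := add_mem hmem (h.mem_homogSpan hw (hlead.symm ▸ hs d))
      rwa [sub_add_cancel] at this
  obtain ⟨d, hd⟩ := h.exists_coeff_eq_zero s
  exact key (d + 1) s hs hs' fun i hi => hd i hi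

/-- Right multiplication by `x ^ M` moves the coefficient at `i` to `i + M` without changing it, so
for large `M` local nilpotence supplies the condition `δ ^ (i + 1) = 0` of `mem_homogSpan_of_coeff`.
-/
theorem exists_mul_x_pow_mem_of_coeff [Nontrivial R] {A : TwoSidedIdeal R} (hA : A.IsStable H)
    (hδ : ∀ a ∈ A, δ a ∈ A) {s : S} (hs : ∀ i, h.coeff i s ∈ A) :
    ∃ M, s * x ^ M ∈ h.homogSpan A := by
  obtain ⟨d, hd⟩ := h.exists_coeff_eq_zero s
  choose m hm using fun i => h.locally_nilpotent (h.coeff i s)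
  set M := (Finset.range (d + 1)).sup m
  refine ⟨M, h.mem_homogSpan_of_coeff hA hδ (fun i => ?_) fun i => ?_⟩ <;>
    rcases lt_or_ge i M with hi | hi
  · rw [h.coeff_mul_x_pow_of_lt hi]; exact A.zero_mem
  · obtain ⟨j, rfl⟩ := Nat.exists_eq_add_of_le' hi
    rw [h.coeff_mul_x_pow]; exact hs j
  · rw [h.coeff_mul_x_pow_of_lt hi, map_zero]
  · obtain ⟨j, rfl⟩ := Nat.exists_eq_add_of_le' hi
    rw [h.coeff_mul_x_pow]
    rcases lt_or_ge d j with hj | hj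
    · rw [hd j hj, map_zero]
    · have : m j ≤ M := Finset.le_sup (f := m) (Finset.mem_range.2 (by omega))
      exact Module.End.pow_apply_eq_zero_of_le (by omega) (hm j)

theorem exists_mul_x_pow_mem [Nontrivial R] (s : S) : ∃ M, s * x ^ M ∈ h.homogSpan ⊤ :=
  h.exists_mul_x_pow_mem_of_coeff (TwoSidedIdeal.isStable_top H)
    (fun _ _ => TwoSidedIdeal.mem_top _) fun _ => TwoSidedIdeal.mem_top _

theorem mul_x_pow_mem {N : TwoSidedIdeal R} {s : S} (hs : s ∈ h.homogSpan N) (M : ℕ) :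
    s * x ^ M ∈ h.homogSpan N := by
  induction hs using AddSubgroup.closure_induction with
  | mem w hw =>
    obtain ⟨p, hw, hp⟩ := hw
    exact h.mem_homogSpan (hw.mul (isHomog_x_pow M)) (by rwa [h.coeff_mul_x_pow])
  | zero => rw [zero_mul]; exact zero_mem _
  | add s t _ _ hs ht => rw [add_mul]; exact add_mem hs ht
  | neg s _ hs => rw [neg_mul]; exact neg_mem hs

theorem mul_x_pow_mem_of_le {N : TwoSidedIdeal R} {s : S} {M M' : ℕ}
    (hs : s * x ^ M ∈ h.homogSpan N) (hM : M ≤ M') : s * x ^ M' ∈ h.homogSpan N := by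
  rw [← Nat.add_sub_cancel' hM, pow_add, ← mul_assoc]
  exact h.mul_x_pow_mem hs _

theorem algebra_smul_mem_homogSpan {N : TwoSidedIdeal R} {s : S} (hs : s ∈ h.homogSpan N)
    (c : k) : c • s ∈ h.homogSpan N := by
  induction hs using AddSubgroup.closure_induction with
  | mem w hw =>
    obtain ⟨p, hw, hp⟩ := hw
    exact h.mem_homogSpan (hw.smul c) (by rw [h.coeff_smul]; exact N.algebra_smul_mem c hp)
  | zero => rw [smul_zero]; exact zero_mem _
  | add s t _ _ hs ht => rw [smul_add]; exact add_mem hs ht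
  | neg s _ hs => rw [smul_neg]; exact neg_mem hs

theorem group_smul_mem_homogSpan [Nontrivial R] {N : TwoSidedIdeal R} (hN : N.IsStable H) {s : S}
    (hs : s ∈ h.homogSpan N) (g : H) : g • s ∈ h.homogSpan N := by
  induction hs using AddSubgroup.closure_induction with
  | mem w hw =>
    obtain ⟨p, hw, hp⟩ := hw
    obtain ⟨γ, hγ⟩ := h.eigenvector g
    refine h.mem_homogSpan (hw.group_smul g) ?_
    rw [h.coeff_group_smul hγ]
    exact N.algebra_smul_mem _ (hN _ _ hp)
  | zero => rw [smul_zero]; exact zero_mem _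
  | add s t _ _ hs ht => rw [smul_add]; exact add_mem hs ht
  | neg s _ hs => rw [smul_neg]; exact neg_mem hs

/-- On a homogeneous element, conjugation by `x` is a scalar times the action of `twist`, which
preserves `homogSpan N`. Powers of `x` can therefore be moved to the other side. -/
theorem exists_mul_x_eq [Nontrivial R] {N : TwoSidedIdeal R} (hN : N.IsStable H) {s : S}
    (hs : s ∈ h.homogSpan N) : ∃ t ∈ h.homogSpan N, s * x = x * t := by
  induction hs using AddSubgroup.closure_induction with
  | mem w hw =>
    obtain ⟨p, hw, hp⟩ := hw
    refine ⟨h.eigenvalue ^ p • (h.twist⁻¹ • w), h.algebra_smul_mem_homogSpan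
      (h.group_smul_mem_homogSpan hN (h.mem_homogSpan hw hp) _) _, ?_⟩
    rw [mul_smul_comm, hw.group_smul h.twist⁻¹, smul_inv_smul]
  | zero => exact ⟨0, zero_mem _, by simp⟩
  | add s t _ _ hs ht =>
    obtain ⟨s', hs', e⟩ := hs
    obtain ⟨t', ht', e'⟩ := ht
    exact ⟨s' + t', add_mem hs' ht', by rw [add_mul, e, e', mul_add]⟩
  | neg s _ hs =>
    obtain ⟨s', hs', e⟩ := hs
    exact ⟨-s', neg_mem hs', by rw [neg_mul, e, mul_neg]⟩

theorem exists_mul_x_pow_eq [Nontrivial R] {N : TwoSidedIdeal R} (hN : N.IsStable H) {s : S}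
    (hs : s ∈ h.homogSpan N) (M : ℕ) : ∃ t ∈ h.homogSpan N, s * x ^ M = x ^ M * t := by
  induction M with
  | zero => exact ⟨s, hs, by simp⟩
  | succ M ih =>
    obtain ⟨t, ht, e⟩ := ih
    obtain ⟨u, hu, e'⟩ := h.exists_mul_x_eq hN ht
    exact ⟨u, hu, by rw [pow_succ, ← mul_assoc, e, mul_assoc, e', ← mul_assoc]⟩

theorem mul_mem_homogSpan [Nontrivial R] {A B C : TwoSidedIdeal R} (hB : B.IsStable H)
    (hAB : ∀ a ∈ A, ∀ b ∈ B, a * b ∈ C) {s t : S} (hs : s ∈ h.homogSpan A)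
    (ht : t ∈ h.homogSpan B) : s * t ∈ h.homogSpan C := by
  induction hs using AddSubgroup.closure_induction with
  | zero => rw [zero_mul]; exact zero_mem _
  | add s s' _ _ hs hs' => rw [add_mul]; exact add_mem hs hs'
  | neg s _ hs => rw [neg_mul]; exact neg_mem hs
  | mem w hw =>
    obtain ⟨p, hw, hp⟩ := hw
    induction ht using AddSubgroup.closure_induction with
    | zero => rw [mul_zero]; exact zero_mem _
    | add s s' _ _ hs hs' => rw [mul_add]; exact add_mem hs hs'
    | neg s _ hs => rw [mul_neg]; exact neg_mem hs
    | mem v hv =>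
      obtain ⟨p', hv, hp'⟩ := hv
      refine h.mem_homogSpan (hw.mul hv) ?_
      rw [(h.coeff_mul_top (fun _ => hw.coeff_eq_zero) (fun _ => hv.coeff_eq_zero)).2]
      exact hAB _ hp _ (h.τ_pow_mem hB hp' p)

theorem exists_mul_mul_x_pow_mem [Nontrivial R] {A B C : TwoSidedIdeal R} (hB : B.IsStable H)
    (hAB : ∀ a ∈ A, ∀ b ∈ B, a * b ∈ C) {s t : S} (hs : ∃ M, s * x ^ M ∈ h.homogSpan A)
    (ht : ∃ M, t * x ^ M ∈ h.homogSpan B) : ∃ M, s * t * x ^ M ∈ h.homogSpan C := by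
  obtain ⟨M, hs⟩ := hs
  obtain ⟨M', ht⟩ := ht
  obtain ⟨u, hu, e⟩ := h.exists_mul_x_pow_eq hB ht M
  refine ⟨M' + M, ?_⟩
  rw [pow_add, mul_assoc, ← mul_assoc t, e, ← mul_assoc]
  exact h.mul_mem_homogSpan hB hAB hs hu

end

/-- The contraction to `R[x; τ, δ]` of the ideal of the localization generated by `C(N)`. -/
noncomputable def homogIdeal [Nontrivial R] (h : IsCauchonExtension H ι x τ δ q)
    (N : TwoSidedIdeal R) (hN : N.IsStable H) : TwoSidedIdeal S :=
  .mk' {s | ∃ M, s * x ^ M ∈ h.homogSpan N} ⟨0, by rw [zero_mul]; exact zero_mem _⟩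
    (fun ⟨M, hs⟩ ⟨M', ht⟩ => ⟨max M M', by
      rw [add_mul]
      exact add_mem (h.mul_x_pow_mem_of_le hs (le_max_left _ _))
        (h.mul_x_pow_mem_of_le ht (le_max_right _ _))⟩)
    (fun ⟨M, hs⟩ => ⟨M, by rw [neg_mul]; exact neg_mem hs⟩)
    (fun {s _} ht => h.exists_mul_mul_x_pow_mem (A := ⊤) hN (fun a _ b hb => N.mul_mem_left a b hb)
      (h.exists_mul_x_pow_mem s) ht)
    (fun {_ t} hs => h.exists_mul_mul_x_pow_mem (B := ⊤) (TwoSidedIdeal.isStable_top H)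
      (fun a ha b _ => N.mul_mem_right a b ha) hs (h.exists_mul_x_pow_mem t))

/-! ### Order, contraction and complete primeness of the ideals `homogIdeal N`. -/

section

variable [Nontrivial R] (h : IsCauchonExtension H ι x τ δ q)
include h

theorem mem_homogIdeal {N : TwoSidedIdeal R} {hN : N.IsStable H} {s : S} :
    s ∈ h.homogIdeal N hN ↔ ∃ M, s * x ^ M ∈ h.homogSpan N := by
  simp [homogIdeal, TwoSidedIdeal.mem_mk']

theorem isStable_homogIdeal {N : TwoSidedIdeal R} (hN : N.IsStable H) :
    (h.homogIdeal N hN).IsStable H := by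
  intro g s hs
  rw [h.mem_homogIdeal] at hs ⊢
  obtain ⟨M, hs⟩ := hs
  obtain ⟨γ, hγ⟩ := h.eigenvector g
  refine ⟨M, ?_⟩
  have := h.algebra_smul_mem_homogSpan (h.group_smul_mem_homogSpan hN hs g) (γ ^ M)⁻¹
  rwa [smul_mul', smul_pow', hγ, smul_pow, mul_smul_comm,
    inv_smul_smul₀ (pow_ne_zero _ (h.group_eigenvalue_ne_zero hγ))] at this

theorem mul_mem_homogIdeal {A B C : TwoSidedIdeal R} {hA : A.IsStable H} {hB : B.IsStable H}
    {hC : C.IsStable H} (hAB : ∀ a ∈ A, ∀ b ∈ B, a * b ∈ C) {s t : S}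
    (hs : s ∈ h.homogIdeal A hA) (ht : t ∈ h.homogIdeal B hB) : s * t ∈ h.homogIdeal C hC := by
  rw [h.mem_homogIdeal] at *
  exact h.exists_mul_mul_x_pow_mem hB hAB hs ht

theorem coeff_mem_of_mem_homogIdeal {N : TwoSidedIdeal R} {hN : N.IsStable H} {s : S}
    (hs : s ∈ h.homogIdeal N hN) {d : ℕ} (hd : ∀ i, d < i → h.coeff i s = 0) :
    h.coeff d s ∈ N := by
  obtain ⟨M, hs⟩ := h.mem_homogIdeal.1 hs
  rw [← h.coeff_mul_x_pow d M]
  refine h.coeff_top_mem hs fun i hi => ?_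
  obtain ⟨j, rfl⟩ := Nat.exists_eq_add_of_le' (show M ≤ i by omega)
  rw [h.coeff_mul_x_pow]
  exact hd j (by omega)

theorem mem_homogIdeal_iff {N : TwoSidedIdeal R} {hN : N.IsStable H} {p : ℕ} {w : S}
    (hw : h.IsHomog p w) : w ∈ h.homogIdeal N hN ↔ h.coeff p w ∈ N :=
  ⟨fun hs => h.coeff_mem_of_mem_homogIdeal hs fun _ => hw.coeff_eq_zero,
    fun hp => h.mem_homogIdeal.2 ⟨0, by simpa using h.mem_homogSpan hw hp⟩⟩

theorem homogIdeal_le_iff {A B : TwoSidedIdeal R} {hA : A.IsStable H} {hB : B.IsStable H} :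
    h.homogIdeal A hA ≤ h.homogIdeal B hB ↔ A ≤ B := by
  constructor
  · intro hle a ha
    obtain ⟨n, hn⟩ := h.locally_nilpotent a
    have hw := h.isHomog_homogLift (Module.End.pow_apply_eq_zero_of_le n.le_succ hn)
    have hc := h.coeff_homogLift_self n a
    rw [← hc]
    exact (h.mem_homogIdeal_iff hw).1 (hle ((h.mem_homogIdeal_iff hw).2 (hc.symm ▸ ha)))
  · intro hle s hs
    obtain ⟨M, hM⟩ := h.mem_homogIdeal.1 hs
    exact h.mem_homogIdeal.2 ⟨M, h.homogSpan_mono hle hM⟩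

theorem x_pow_not_mem_homogIdeal {N : TwoSidedIdeal R} (hN : N.IsStable H) (hne : N ≠ ⊤) (n : ℕ) :
    x ^ n ∉ h.homogIdeal N hN := by
  rw [h.mem_homogIdeal_iff (isHomog_x_pow n), h.coeff_x_pow, if_pos rfl]
  rwa [TwoSidedIdeal.one_mem_iff]

theorem mem_of_ι_mem_homogIdeal {N : TwoSidedIdeal R} {hN : N.IsStable H} {r : R}
    (hr : ι r ∈ h.homogIdeal N hN) : r ∈ N := by
  have := h.coeff_mem_of_mem_homogIdeal hr (d := 0)
    (fun i hi => by rw [h.coeff_ι, if_neg hi.ne'])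
  rwa [h.coeff_ι, if_pos rfl] at this

/-- With `mem_of_ι_mem_homogIdeal` this identifies the contraction of `homogIdeal N` to `R` as the
largest `H`- and `δ`-stable ideal contained in `N`. -/
theorem ι_mem_homogIdeal {A N : TwoSidedIdeal R} {hN : N.IsStable H} (hA : A.IsStable H)
    (hδ : ∀ a ∈ A, δ a ∈ A) (hAN : A ≤ N) {a : R} (ha : a ∈ A) : ι a ∈ h.homogIdeal N hN := by
  obtain ⟨M, hM⟩ := h.exists_mul_x_pow_mem_of_coeff hA hδ (s := ι a) fun i => by
    rw [h.coeff_ι]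
    split_ifs
    exacts [ha, A.zero_mem]
  exact h.mem_homogIdeal.2 ⟨M, h.homogSpan_mono hAN hM⟩

/-- Discard top components with leading coefficient in `N` until one with leading coefficient
outside `N` appears. -/
theorem exists_top_not_mem {N : TwoSidedIdeal R} {s : S} (hs : s ∈ h.homogSpan ⊤)
    (hs' : s ∉ h.homogSpan N) : ∃ (u : S) (p : ℕ), s - u ∈ h.homogSpan N ∧
      (∀ i, p < i → h.coeff i u = 0) ∧ h.coeff p u ∉ N := by
  obtain ⟨f, K, hf, rfl⟩ := h.exists_homog_sum hs
  clear hs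
  induction K with
  | zero => exact absurd (zero_mem _) hs'
  | succ K ih =>
    by_cases hK : h.coeff K (f K) ∈ N
    · have hfK := h.mem_homogSpan (hf K).1 hK
      obtain ⟨u, p, hu, hu'⟩ := ih fun hmem => hs' (by
        rw [Finset.sum_range_succ]; exact add_mem hmem hfK)
      refine ⟨u, p, ?_, hu'⟩
      rw [Finset.sum_range_succ, add_sub_right_comm]
      exact add_mem hu hfK
    · have hlt : ∀ j, K ≤ j → h.coeff j (∑ p ∈ Finset.range K, f p) = 0 := fun j hj => by
        rw [map_sum]
        exact Finset.sum_eq_zero fun p hp =>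
          (hf p).1.coeff_eq_zero ((Finset.mem_range.1 hp).trans_le hj)
      refine ⟨_, K, by rw [sub_self]; exact zero_mem _, fun i hi => ?_, ?_⟩
      · rw [Finset.sum_range_succ, map_add, hlt i hi.le, zero_add, (hf K).1.coeff_eq_zero hi]
      · rwa [Finset.sum_range_succ, map_add, hlt K le_rfl, zero_add]

/-- This is the leading-term proof that a skew polynomial ring over a domain is a domain. Modulo
`homogSpan N` both factors may be assumed to have leading coefficients outside `N`; the leading
coefficient of the product is then `a τ ^ p(b)`, also outside `N`. -/
theorem mem_or_mem_homogSpan {N : TwoSidedIdeal R} (hN : N.IsStable H) (hP : N.IsCompletelyPrime)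
    {s t : S} (hs : s ∈ h.homogSpan ⊤) (ht : t ∈ h.homogSpan ⊤) (hst : s * t ∈ h.homogSpan N) :
    s ∈ h.homogSpan N ∨ t ∈ h.homogSpan N := by
  by_contra! hne
  obtain ⟨u, p, hu, hu', hup⟩ := h.exists_top_not_mem hs hne.1
  obtain ⟨v, p', hv, hv', hvp⟩ := h.exists_top_not_mem ht hne.2
  have hut : u ∈ h.homogSpan ⊤ := by
    simpa using sub_mem hs (h.homogSpan_le_top N hu)
  have huv : u * v ∈ h.homogSpan N := by
    have e : u * v = s * t - (s - u) * t - u * (t - v) := by noncomm_ring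
    rw [e]
    refine sub_mem (sub_mem hst (h.mul_mem_homogSpan (TwoSidedIdeal.isStable_top H)
      (fun a ha b _ => N.mul_mem_right a b ha) hu ht)) (h.mul_mem_homogSpan hN
      (fun a _ b hb => N.mul_mem_left a b hb) hut hv)
  have htop := h.coeff_mul_top hu' hv'
  have := h.coeff_top_mem huv htop.1
  rw [htop.2] at this
  exact (hP.mem_or_mem _ _ this).elim hup fun h' => hvp (h.mem_of_τ_pow_mem hN h')

theorem isCompletelyPrime_homogIdeal {N : TwoSidedIdeal R} (hN : N.IsStable H)
    (hP : N.IsCompletelyPrime) : (h.homogIdeal N hN).IsCompletelyPrime where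
  ne_top htop := h.x_pow_not_mem_homogIdeal hN hP.ne_top 0 (htop ▸ TwoSidedIdeal.mem_top _)
  mem_or_mem s t hst := by
    rw [h.mem_homogIdeal] at *
    rw [h.mem_homogIdeal]
    obtain ⟨M, hM⟩ := h.exists_mul_x_pow_mem s
    obtain ⟨M', hM'⟩ := h.exists_mul_x_pow_mem t
    obtain ⟨K, hK⟩ := hst
    -- The exponent `max M' K` clears `t`, and it is also large enough for the power of `x` that
    -- remains after `s t` to absorb `K`.
    obtain ⟨u, hu, e⟩ := h.exists_mul_x_pow_eq (TwoSidedIdeal.isStable_top H)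
      (h.mul_x_pow_mem_of_le hM' (le_max_left M' K)) M
    have hsu : s * x ^ M * u ∈ h.homogSpan N := by
      rw [mul_assoc, ← e, mul_assoc, ← pow_add, ← mul_assoc]
      exact h.mul_x_pow_mem_of_le hK ((le_max_right _ _).trans (Nat.le_add_right _ _))
    rcases h.mem_or_mem_homogSpan hN hP hM hu hsu with h' | h'
    · exact Or.inl ⟨M, h'⟩
    · refine Or.inr ⟨max M' K + M, ?_⟩
      rw [pow_add, ← mul_assoc, e]
      exact h.mul_mem_homogSpan (A := ⊤) hN (fun a _ b hb => N.mul_mem_left a b hb)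
        (h.mem_homogSpan (isHomog_x_pow M) (TwoSidedIdeal.mem_top _)) h'

end

end IsCauchonExtension

/-! ### Ideals of a Cauchon extension that contain `x` -/

namespace IsOreExtension

variable {k R S : Type*} [Field k] [Ring R] [Algebra k R] [Ring S] [Algebra k S]
  {ι : R →ₐ[k] S} {x : S} {τ : R ≃ₐ[k] R} {δ : R →ₗ[k] R}

/-- The constant coefficient of `x s` is `δ` of that of `s`, hence zero modulo `P`. So taking
constant coefficients modulo `P` is a ring homomorphism, and `constIdeal` is its kernel. -/
theorem coeff_zero_mul_sub_mem (h : IsOreExtension ι x τ δ) {P : TwoSidedIdeal R}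
    (hδ : ∀ r, δ r ∈ P) (s t : S) : h.coeff 0 (s * t) - h.coeff 0 s * h.coeff 0 t ∈ P := by
  induction s using h.induction_monomial with
  | hmon n r =>
    cases n with
    | zero => simp [h.coeff_ι_mul, h.coeff_ι, P.zero_mem]
    | succ n =>
      rw [h.coeff_monomial, if_neg (by omega), zero_mul, sub_zero, mul_assoc, h.coeff_ι_mul,
        pow_succ', mul_assoc, h.coeff_x_mul_zero]
      exact P.mul_mem_left _ _ (hδ _)
  | hadd s s' hs hs' =>
    rw [add_mul, map_add, map_add, add_mul, add_sub_add_comm]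
    exact P.add_mem hs hs'

/-- The ideal of the elements with constant coefficient in `P`, for an ideal `P` containing the
image of `δ`. -/
noncomputable def constIdeal (h : IsOreExtension ι x τ δ) (P : TwoSidedIdeal R)
    (hδ : ∀ r, δ r ∈ P) : TwoSidedIdeal S :=
  .mk' {s | h.coeff 0 s ∈ P} (by simp [P.zero_mem])
    (fun {s t} hs ht => by
      change h.coeff 0 (s + t) ∈ P; rw [map_add]; exact P.add_mem hs ht)
    (fun {s} hs => by change h.coeff 0 (-s) ∈ P; rw [map_neg]; exact P.neg_mem hs)
    (fun {s t} ht => by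
      have := P.add_mem (h.coeff_zero_mul_sub_mem hδ s t) (P.mul_mem_left (h.coeff 0 s) _ ht)
      rwa [sub_add_cancel] at this)
    (fun {s t} hs => by
      have := P.add_mem (h.coeff_zero_mul_sub_mem hδ s t) (P.mul_mem_right _ (h.coeff 0 t) hs)
      rwa [sub_add_cancel] at this)

variable (h : IsOreExtension ι x τ δ)
include h

theorem mem_constIdeal {P : TwoSidedIdeal R} {hδ : ∀ r, δ r ∈ P} {s : S} :
    s ∈ h.constIdeal P hδ ↔ h.coeff 0 s ∈ P := by
  simp [constIdeal, TwoSidedIdeal.mem_mk']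

theorem ι_mem_constIdeal {P : TwoSidedIdeal R} {hδ : ∀ r, δ r ∈ P} {r : R} :
    ι r ∈ h.constIdeal P hδ ↔ r ∈ P := by
  rw [h.mem_constIdeal, h.coeff_ι, if_pos rfl]

theorem x_mem_constIdeal {P : TwoSidedIdeal R} {hδ : ∀ r, δ r ∈ P} :
    x ∈ h.constIdeal P hδ := by
  have := h.coeff_x_pow 0 1
  rw [pow_one, if_neg zero_ne_one] at this
  rw [h.mem_constIdeal, this]
  exact P.zero_mem

theorem mem_iff_of_x_mem {I : TwoSidedIdeal S} (hx : x ∈ I) (s : S) :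
    s ∈ I ↔ ι (h.coeff 0 s) ∈ I := by
  have key : s - ι (h.coeff 0 s) ∈ I := by
    induction s using h.induction_monomial with
    | hmon n r =>
      cases n with
      | zero => simp [h.coeff_ι, I.zero_mem]
      | succ n =>
        rw [h.coeff_monomial, if_neg (by omega), map_zero, sub_zero, pow_succ, ← mul_assoc]
        exact I.mul_mem_left _ _ hx
    | hadd s s' hs hs' => rw [map_add, map_add, add_sub_add_comm]; exact I.add_mem hs hs'
  constructor
  · intro hs; simpa using I.sub_mem hs key
  · intro hs; simpa using I.add_mem key hs

theorem constIdeal_eq_span {P : TwoSidedIdeal R} (hδ : ∀ r, δ r ∈ P) :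
    h.constIdeal P hδ = TwoSidedIdeal.span (ι '' (P : Set R) ∪ {x}) := by
  refine le_antisymm (fun s hs => ?_) (TwoSidedIdeal.span_le.2 ?_)
  · rw [h.mem_iff_of_x_mem (TwoSidedIdeal.subset_span (Or.inr rfl))]
    exact TwoSidedIdeal.subset_span (Or.inl ⟨_, h.mem_constIdeal.1 hs, rfl⟩)
  · rintro _ (⟨r, hr, rfl⟩ | rfl)
    · exact h.ι_mem_constIdeal.2 hr
    · exact h.x_mem_constIdeal

theorem isCompletelyPrime_constIdeal {P : TwoSidedIdeal R} (hδ : ∀ r, δ r ∈ P)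
    (hP : P.IsCompletelyPrime) : (h.constIdeal P hδ).IsCompletelyPrime where
  ne_top htop := hP.ne_top (P.one_mem_iff.1 (h.ι_mem_constIdeal.1
    (show ι 1 ∈ h.constIdeal P hδ from htop ▸ TwoSidedIdeal.mem_top _)))
  mem_or_mem s t hst := by
    rw [h.mem_constIdeal] at *
    rw [h.mem_constIdeal]
    have := P.sub_mem hst (h.coeff_zero_mul_sub_mem hδ s t)
    rw [sub_sub_cancel] at this
    exact hP.mem_or_mem _ _ this

theorem δ_comap_mem (I : TwoSidedIdeal S) : ∀ r ∈ I.comap ι, τ r ∈ I.comap ι →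
    δ r ∈ I.comap ι := by
  intro r hr hr'
  rw [TwoSidedIdeal.mem_comap] at *
  have : ι (δ r) = x * ι r - ι (τ r) * x := by rw [h.commute, add_sub_cancel_left]
  rw [this]
  exact I.sub_mem (I.mul_mem_left _ _ hr) (I.mul_mem_right _ _ hr')

end IsOreExtension

theorem TwoSidedIdeal.mem_of_algebra_smul_mem {k A : Type*} [Field k] [Ring A] [Algebra k A]
    {I : TwoSidedIdeal A} {c : k} (hc : c ≠ 0) {a : A} (ha : c • a ∈ I) : a ∈ I := by
  simpa [inv_smul_smul₀ hc] using I.algebra_smul_mem c⁻¹ ha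

theorem TwoSidedIdeal.IsCompletelyPrime.comap {R S F : Type*} [Ring R] [Ring S] [FunLike F R S]
    [RingHomClass F R S] {I : TwoSidedIdeal S} (hI : I.IsCompletelyPrime) (f : F) :
    (I.comap f).IsCompletelyPrime where
  ne_top htop := hI.ne_top (I.one_mem_iff.1 (by
    rw [← map_one f, ← TwoSidedIdeal.mem_comap, htop]; exact TwoSidedIdeal.mem_top _))
  mem_or_mem a b hab := by
    rw [TwoSidedIdeal.mem_comap, map_mul] at hab
    rw [TwoSidedIdeal.mem_comap, TwoSidedIdeal.mem_comap]
    exact hI.mem_or_mem _ _ hab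

namespace IsCauchonExtension

variable {H k R S : Type*} [Field k] [Ring R] [Algebra k R]
  [Ring S] [Algebra k S] [CommGroup H] [MulSemiringAction H R] [MulSemiringAction H S]
  {ι : R →ₐ[k] S} {x : S} {τ : R ≃ₐ[k] R} {δ : R →ₗ[k] R} {q : kˣ}
  (h : IsCauchonExtension H ι x τ δ q)
include h

theorem δ_τ_pow (n : ℕ) (r : R) : δ ((τ ^ n) r) = (q : k) ^ n • (τ ^ n) (δ r) := by
  induction n with
  | zero => simp
  | succ n ih =>
    rw [pow_succ', AlgEquiv.mul_apply, h.q_commute, ih, map_smul, smul_smul, ← pow_succ',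
      AlgEquiv.mul_apply]

theorem isStable_constIdeal {P : TwoSidedIdeal R} (hP : P.IsStable H) (hδ : ∀ r, δ r ∈ P) :
    (h.constIdeal P hδ).IsStable H := by
  intro g s hs
  obtain ⟨γ, hγ⟩ := h.eigenvector g
  rw [h.mem_constIdeal] at *
  rw [h.coeff_group_smul hγ, pow_zero, one_smul]
  exact hP _ _ hs

theorem isStable_comap {I : TwoSidedIdeal S} (hI : I.IsStable H) : (I.comap ι).IsStable H := by
  intro g r hr
  rw [TwoSidedIdeal.mem_comap] at *
  rw [← h.equivariant]
  exact hI _ _ hr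

theorem δ_mem_comap {I : TwoSidedIdeal S} (hI : I.IsStable H) : ∀ r ∈ I.comap ι,
    δ r ∈ I.comap ι :=
  fun r hr => h.δ_comap_mem I r hr (h.τ_mem (h.isStable_comap hI) hr)

theorem δ_mem_comap_of_x_mem {I : TwoSidedIdeal S} (hx : x ∈ I) (r : R) : δ r ∈ I.comap ι := by
  rw [TwoSidedIdeal.mem_comap]
  have : ι (δ r) = x * ι r - ι (τ r) * x := by rw [h.commute, add_sub_cancel_left]
  rw [this]
  exact I.sub_mem (I.mul_mem_right _ _ hx) (I.mul_mem_left _ _ hx)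

theorem isStable_coeffIdeal {A : TwoSidedIdeal R} (hA : A.IsStable H) (hτ : ∀ a ∈ A, τ a ∈ A)
    (hδ : ∀ a ∈ A, δ a ∈ A) : (h.coeffIdeal A hτ hδ).IsStable H := by
  intro g s hs
  obtain ⟨γ, hγ⟩ := h.eigenvector g
  rw [h.mem_coeffIdeal] at *
  intro n
  rw [h.coeff_group_smul hγ]
  exact A.algebra_smul_mem _ (hA _ _ (hs n))

/-- Multiplication by `x` on the left and on the right, twisted so that the homogeneous elements of
degree `D` are annihilated. -/
theorem twisted_commutator_mem {I : TwoSidedIdeal S} (hI : I.IsStable H) (D : ℕ) {s : S}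
    (hs : s ∈ I) : h.eigenvalue ^ D • (x * s) - (h.twist • s) * x ∈ I :=
  I.sub_mem (I.algebra_smul_mem _ (I.mul_mem_left _ _ hs)) (I.mul_mem_right _ _ (hI _ _ hs))

theorem coeff_twisted_commutator_zero (D : ℕ) (s : S) :
    h.coeff 0 (h.eigenvalue ^ D • (x * s) - (h.twist • s) * x) =
      h.eigenvalue ^ D • δ (h.coeff 0 s) := by
  rw [map_sub, h.coeff_smul, h.coeff_x_mul_zero, h.coeff_mul_x_zero, sub_zero]

theorem coeff_twisted_commutator_succ (D i : ℕ) (s : S) :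
    h.coeff (i + 1) (h.eigenvalue ^ D • (x * s) - (h.twist • s) * x) =
      (h.eigenvalue ^ D - h.eigenvalue ^ i) • τ (h.coeff i s) +
        h.eigenvalue ^ D • δ (h.coeff (i + 1) s) := by
  rw [map_sub, h.coeff_smul, h.coeff_x_mul_succ, h.coeff_mul_x_succ, h.coeff_twist_smul, smul_add,
    sub_smul]
  abel

/-- An `H`-stable ideal of `R[x; τ, δ]` whose contraction to `R` lies in `P` is contained in the
ideal generated by `P` and `x`. -/
theorem le_constIdeal [Nontrivial R] {P : TwoSidedIdeal R} (hPs : P.IsStable H)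
    (hP : P.IsCompletelyPrime) (hδ : ∀ r, δ r ∈ P) {Q : TwoSidedIdeal S} (hQ : Q.IsStable H)
    (hQP : Q.comap ι ≤ P) : Q ≤ h.constIdeal P hδ := by
  -- Induction on the degree: if the constant coefficient of `s` is not in `P`, a second element of
  -- `Q` is built whose top coefficient is outside `P` and whose lower ones are in `P`, and it is
  -- used to lower the degree of `s`.
  have key : ∀ d : ℕ, ∀ s ∈ Q, (∀ i, d < i → h.coeff i s = 0) → h.coeff 0 s ∈ P := by
    intro d
    induction d with
    | zero =>
      intro s hs hd
      rw [h.eq_sum_coeff hd] at hs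
      exact hQP (by simpa [TwoSidedIdeal.mem_comap] using hs)
    | succ d ih =>
      intro s hs hd
      by_contra h0
      -- Modulo `P` the twisted commutator moves the coefficient at `i` to `i + 1`, up to `τ` and
      -- the scalar `λ ^ (d + 1) - λ ^ i`. This is nonzero for `i ≤ d` and zero at `i = d + 1`, so
      -- the degree never exceeds `d + 1`.
      have step : ∀ m ≤ d + 1, ∃ w ∈ Q, (∀ i, d + 1 < i → h.coeff i w = 0) ∧
          (∀ i < m, h.coeff i w ∈ P) ∧ h.coeff m w ∉ P := by
        intro m
        induction m with
        | zero => exact fun _ => ⟨s, hs, hd, by simp, h0⟩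
        | succ m ihm =>
          intro hm
          obtain ⟨w, hw, hwd, hwm, hwm'⟩ := ihm (by omega)
          refine ⟨_, h.twisted_commutator_mem hQ (d + 1) hw, ?_, ?_, ?_⟩
          · rintro (_ | i) hi
            · omega
            · rw [coeff_twisted_commutator_succ, hwd (i + 1) hi, map_zero, smul_zero, add_zero]
              rcases (Nat.lt_succ_iff.1 hi).eq_or_lt with rfl | hi
              · rw [sub_self, zero_smul]
              · rw [hwd i hi, map_zero, smul_zero]
          · rintro (_ | i) hi
            · rw [coeff_twisted_commutator_zero]; exact P.algebra_smul_mem _ (hδ _)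
            · rw [coeff_twisted_commutator_succ]
              exact P.add_mem (P.algebra_smul_mem _ (h.τ_mem hPs (hwm i (by omega))))
                (P.algebra_smul_mem _ (hδ _))
          · rw [coeff_twisted_commutator_succ]
            intro hmem
            have := P.sub_mem hmem
              (P.algebra_smul_mem (h.eigenvalue ^ (d + 1)) (hδ (h.coeff (m + 1) w)))
            rw [add_sub_cancel_right] at this
            refine hwm' (h.mem_of_τ_mem hPs (TwoSidedIdeal.mem_of_algebra_smul_mem
              (sub_ne_zero.2 fun e => ?_) this))
            have := h.eigenvalue_pow_injective e
            omega
      obtain ⟨w, hw, hwd, hwm, hwm'⟩ := step (d + 1) le_rfl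
      set a := h.coeff (d + 1) w
      -- With this `b` the elements `a s` and `w b` have the same coefficient at `x ^ (d + 1)`.
      -- Modulo `P` their difference has constant coefficient `a` times that of `s`.
      set b := (τ ^ (d + 1)).symm (h.coeff (d + 1) s)
      have hb : ∀ i, 0 < i → h.coeff i (ι b) = 0 := fun i hi => by rw [h.coeff_ι, if_neg hi.ne']
      have htop := h.coeff_mul_top hwd hb
      have hu := ih (ι a * s - w * ι b) (Q.sub_mem (Q.mul_mem_left _ _ hs) (Q.mul_mem_right _ _ hw))
        fun i hi => by
          rw [map_sub, h.coeff_ι_mul]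
          rcases (Nat.succ_le_iff.2 hi).eq_or_lt with rfl | hi
          · have e := htop.2
            rw [add_zero, h.coeff_ι, if_pos rfl, AlgEquiv.apply_symm_apply] at e
            rw [Nat.succ_eq_add_one, e, sub_self]
          · rw [hd i hi, htop.1 i hi, mul_zero, sub_zero]
      rw [map_sub, h.coeff_ι_mul] at hu
      have hwb : h.coeff 0 (w * ι b) ∈ P := by
        have := P.add_mem (h.coeff_zero_mul_sub_mem hδ w (ι b))
          (P.mul_mem_right _ (h.coeff 0 (ι b)) (hwm 0 d.succ_pos))
        rwa [sub_add_cancel] at this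
      have := P.add_mem hu hwb
      rw [sub_add_cancel] at this
      exact (hP.mem_or_mem _ _ this).elim hwm' h0
  intro s hs
  obtain ⟨d, hd⟩ := h.exists_coeff_eq_zero s
  exact h.mem_constIdeal.2 (key d s hs hd)

end IsCauchonExtension

/-! ### The `H`-prime ideals of a Cauchon extension -/

namespace IsCauchonExtension

variable {H k R S : Type*} [Field k] [Ring R] [Algebra k R]
  [Ring S] [Algebra k S] [CommGroup H] [MulSemiringAction H R] [MulSemiringAction H S]
  {ι : R →ₐ[k] S} {x : S} {τ : R ≃ₐ[k] R} {δ : R →ₗ[k] R} {q : kˣ}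

section

variable (h : IsCauchonExtension H ι x τ δ q)
include h

/-- The extensions `A[x; τ, δ]` and `B[x; τ, δ]` are `H`-stable ideals of `S` with product in `I`.
Primeness of the contraction is obtained only for `δ`-stable ideals here; `isCompletelyPrime_comap`
removes this restriction. -/
theorem le_comap_or_le_comap {I : TwoSidedIdeal S} (hI : I.IsHPrime H) {A B : TwoSidedIdeal R}
    (hA : A.IsStable H) (hB : B.IsStable H) (hAδ : ∀ a ∈ A, δ a ∈ A) (hBδ : ∀ b ∈ B, δ b ∈ B)
    (hAB : ∀ a ∈ A, ∀ b ∈ B, a * b ∈ I.comap ι) : A ≤ I.comap ι ∨ B ≤ I.comap ι := by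
  have hAτ : ∀ a ∈ A, τ a ∈ A := fun _ => h.τ_mem hA
  have hBτ : ∀ b ∈ B, τ b ∈ B := fun _ => h.τ_mem hB
  have hle : ∀ {C : TwoSidedIdeal R} {hτ : ∀ a ∈ C, τ a ∈ C} {hδ : ∀ a ∈ C, δ a ∈ C},
      h.coeffIdeal C hτ hδ ≤ I → C ≤ I.comap ι := fun {C _ _} hle c hc => by
    rw [TwoSidedIdeal.mem_comap]
    refine hle (h.mem_coeffIdeal.2 fun n => ?_)
    rw [h.coeff_ι]
    split_ifs
    exacts [hc, C.zero_mem]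
  refine (hI.le_or_le (h.coeffIdeal A hAτ hAδ) (h.coeffIdeal B hBτ hBδ)
    (h.isStable_coeffIdeal hA _ _) (h.isStable_coeffIdeal hB _ _) fun s hs t ht => ?_).imp hle hle
  exact h.mem_of_coeff_mem fun n => (TwoSidedIdeal.mem_comap ι).1
    (h.coeff_mul_mem hBτ hBδ hAB (h.mem_coeffIdeal.1 hs) (h.mem_coeffIdeal.1 ht) n)

/-- The contraction to `R` of an `H`-prime ideal of `R[x; τ, δ]` is completely prime. -/
theorem isCompletelyPrime_comap [Nontrivial R] {I : TwoSidedIdeal S} (hI : I.IsHPrime H) :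
    (I.comap ι).IsCompletelyPrime := by
  have := h.noetherian_left
  set P := I.comap ι with hPdef
  have hPs : P.IsStable H := h.isStable_comap hI.stable
  have hPδ : ∀ r ∈ P, δ r ∈ P := h.δ_mem_comap hI.stable
  -- Choose `N ⊇ P` maximal among the `H`-stable ideals whose `homogIdeal` contracts into `P`. Then
  -- `N` is `H`-prime, hence completely prime by hypothesis, and `P` inherits this as the
  -- contraction of `homogIdeal N`. The set consists of left ideals only in order to use that `R` is
  -- left noetherian.
  let F : Set (Ideal R) := {J | ∃ (A : TwoSidedIdeal R) (hA : A.IsStable H), P ≤ A ∧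
    (∀ r, ι r ∈ h.homogIdeal A hA → r ∈ P) ∧ A.asIdeal = J}
  obtain ⟨_, ⟨N, hN, hPN, hNP, rfl⟩, hmax⟩ := set_has_maximal_iff_noetherian.2 this F
    ⟨_, P, hPs, le_rfl, fun r hr => h.mem_of_ι_mem_homogIdeal hr, rfl⟩
  have hsup : ∀ A : TwoSidedIdeal R, A.IsStable H → ¬ A ≤ N → ∃ (hAN : (A ⊔ N).IsStable H) (r : R),
      ι r ∈ h.homogIdeal (A ⊔ N) hAN ∧ r ∉ P := by
    intro A hA hAN
    have hs : (A ⊔ N).IsStable H := by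
      intro g a ha
      obtain ⟨b, hb, c, hc, rfl⟩ := TwoSidedIdeal.mem_sup.1 ha
      rw [smul_add]
      exact TwoSidedIdeal.add_mem _ (TwoSidedIdeal.mem_sup_left (hA _ _ hb))
        (TwoSidedIdeal.mem_sup_right (hN _ _ hc))
    refine ⟨hs, ?_⟩
    by_contra! hne
    refine hmax _ ⟨A ⊔ N, hs, hPN.trans le_sup_right, hne, rfl⟩
      (lt_of_le_not_ge (fun a ha => TwoSidedIdeal.mem_sup_right ha) fun hle => ?_)
    exact hAN fun a ha => hle (TwoSidedIdeal.mem_sup_left (J := N) ha)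
  have hNprime : N.IsHPrime H := by
    refine ⟨?_, hN, fun A B hA hB hAB => ?_⟩
    · rintro rfl
      refine hI.ne_top (I.one_mem_iff.1 ?_)
      rw [← map_one ι, ← TwoSidedIdeal.mem_comap]
      refine hNP 1 ?_
      have := (h.mem_homogIdeal_iff (hN := hN) (isHomog_x_pow 0)).2 (TwoSidedIdeal.mem_top _)
      rwa [pow_zero, ← map_one ι] at this
    · by_contra! hne
      obtain ⟨hAN, a, ha, haP⟩ := hsup A hA hne.1
      obtain ⟨hBN, b, hb, hbP⟩ := hsup B hB hne.2
      have hAB' : ∀ a ∈ A ⊔ N, ∀ b ∈ B ⊔ N, a * b ∈ N := by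
        intro a ha b hb
        obtain ⟨a', ha', c, hc, rfl⟩ := TwoSidedIdeal.mem_sup.1 ha
        obtain ⟨b', hb', d, hd, rfl⟩ := TwoSidedIdeal.mem_sup.1 hb
        rw [add_mul, mul_add]
        exact N.add_mem (N.add_mem (hAB a' ha' b' hb') (N.mul_mem_left _ _ hd))
          (N.mul_mem_right _ _ hc)
      -- Contractions from `S` are automatically `δ`-stable, so the restricted primeness of `P`
      -- applies to those of `homogIdeal (A ⊔ N)` and `homogIdeal (B ⊔ N)`; maximality of `N` rules
      -- out both alternatives.
      have hst : ∀ {C : TwoSidedIdeal R} (hC : C.IsStable H),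
          ((h.homogIdeal C hC).comap ι).IsStable H ∧
            ∀ c ∈ (h.homogIdeal C hC).comap ι, δ c ∈ (h.homogIdeal C hC).comap ι := fun hC =>
        ⟨h.isStable_comap (h.isStable_homogIdeal hC), h.δ_mem_comap (h.isStable_homogIdeal hC)⟩
      rcases h.le_comap_or_le_comap hI (hst hAN).1 (hst hBN).1 (hst hAN).2 (hst hBN).2
        (fun a ha b hb => hNP _ (by
          rw [map_mul]
          exact h.mul_mem_homogIdeal hAB' ((TwoSidedIdeal.mem_comap ι).1 ha)
            ((TwoSidedIdeal.mem_comap ι).1 hb))) with hle | hle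
      · exact haP (hle ((TwoSidedIdeal.mem_comap ι).2 ha))
      · exact hbP (hle ((TwoSidedIdeal.mem_comap ι).2 hb))
  have hP : P = (h.homogIdeal N hN).comap ι := by
    refine le_antisymm (fun r hr => ?_) fun r hr => hNP r ((TwoSidedIdeal.mem_comap ι).1 hr)
    exact (TwoSidedIdeal.mem_comap ι).2 (h.ι_mem_homogIdeal hPs hPδ hPN hr)
  rw [hP]
  exact (h.isCompletelyPrime_homogIdeal hN (h.completely_prime N hNprime)).comap ι

theorem δ_one : δ 1 = 0 := by simpa using h.skew 1 1

theorem δ_τ_pow_mem {P : TwoSidedIdeal R} (hP : P.IsStable H) {b : R} (hb : δ b ∈ P) (n : ℕ) :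
    δ ((τ ^ n) b) ∈ P := by
  rw [h.δ_τ_pow]; exact P.algebra_smul_mem _ (h.τ_pow_mem hP hb n)

theorem δ_mem_of_δ_τ_pow_mem {P : TwoSidedIdeal R} (hP : P.IsStable H) {b : R} {n : ℕ}
    (hb : δ ((τ ^ n) b) ∈ P) : δ b ∈ P := by
  rw [h.δ_τ_pow] at hb
  exact h.mem_of_τ_pow_mem hP
    (TwoSidedIdeal.mem_of_algebra_smul_mem (pow_ne_zero _ q.ne_zero) hb)

theorem x_pow_mul_sub_mem {I : TwoSidedIdeal S} (hI : I.IsStable H) {b : R}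
    (hb : δ b ∈ I.comap ι) (n : ℕ) : x ^ n * ι b - ι ((τ ^ n) b) * x ^ n ∈ I := by
  induction n with
  | zero => simp [I.zero_mem]
  | succ n ih =>
    have h1 := (TwoSidedIdeal.mem_comap ι).1 (h.δ_τ_pow_mem (h.isStable_comap hI) hb n)
    have := I.add_mem (I.mul_mem_left x _ ih) (I.mul_mem_right _ (x ^ n) h1)
    rwa [mul_sub, ← mul_assoc, ← mul_assoc, ← pow_succ', h.commute, add_mul, mul_assoc,
      ← pow_succ' x n, ← AlgEquiv.mul_apply, ← pow_succ', ← sub_sub, sub_add_cancel] at this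

/-- The `q`-Leibniz formula for `x ^ (j + 1) r`, cut off after the term with one `δ`. -/
theorem x_pow_succ_mul_sub_mem {I : TwoSidedIdeal S} (hI : I.IsStable H) {r : R}
    (hr : δ (δ r) ∈ I.comap ι) (j : ℕ) :
    x ^ (j + 1) * ι r - (ι ((τ ^ (j + 1)) r) * x ^ (j + 1) +
      (∑ i ∈ Finset.range (j + 1), (q : k) ^ i) • (ι ((τ ^ j) (δ r)) * x ^ j)) ∈ I := by
  induction j with
  | zero =>
    simp only [zero_add, pow_one, pow_zero, Finset.sum_range_one, one_smul, mul_one, h.commute,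
      AlgEquiv.one_apply, sub_self]
    exact I.zero_mem
  | succ j ih =>
    have h1 := (TwoSidedIdeal.mem_comap ι).1 (h.δ_τ_pow_mem (h.isStable_comap hI) hr j)
    have := I.add_mem (I.mul_mem_left x _ ih) (I.algebra_smul_mem
      (∑ i ∈ Finset.range (j + 1), (q : k) ^ i) (I.mul_mem_right _ (x ^ j) h1))
    convert this using 1
    rw [mul_sub, mul_add, mul_smul_comm, ← mul_assoc x (ι _), ← mul_assoc x (ι _), h.commute,
      h.commute, h.δ_τ_pow, ← mul_assoc x (x ^ (j + 1)), ← pow_succ', ← AlgEquiv.mul_apply,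
      ← AlgEquiv.mul_apply, ← pow_succ' τ, ← pow_succ' τ, map_smul,
      Finset.sum_range_succ _ (j + 1), add_smul, add_mul, add_mul, mul_assoc _ x, mul_assoc _ x,
      ← pow_succ', ← pow_succ', smul_mul_assoc, smul_add]
    abel

theorem δ_mul_mem {P : TwoSidedIdeal R} {a b : R} (ha : δ a ∈ P) (hb : δ b ∈ P) :
    δ (a * b) ∈ P := by
  rw [h.skew]; exact P.add_mem (P.mul_mem_left _ _ hb) (P.mul_mem_right _ _ ha)

/-- If `δ(R) ⊆ I`, then `x` is normal modulo `I`, and primeness lowers the exponent. Otherwise local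
nilpotence gives an `r` with `δ(r) ∉ I` and `δ²(r) ∈ I`, and commuting with `r` strips off powers of
`x` until a nonzero element of `R` modulo `I ∩ R` would lie in `I`. -/
theorem x_mem_of_x_pow_mem [Nontrivial R] {I : TwoSidedIdeal S} (hI : I.IsHPrime H) {n : ℕ}
    (hn : x ^ n ∈ I) : x ∈ I := by
  have hP := h.isCompletelyPrime_comap hI
  have hs := hI.stable
  have hPs := h.isStable_comap hs
  have hPδ := h.δ_mem_comap hs
  by_cases hδ : ∀ r, δ r ∈ I.comap ι
  · induction n with
    | zero => exact absurd (I.one_mem_iff.1 (by simpa using hn)) hI.ne_top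
    | succ n ih =>
      refine (hI.mem_or_mem_of_eigenvector (a := x ^ n) h.eigenvector fun s => ?_).elim ih id
      induction s using h.induction_monomial with
      | hmon j r =>
        have := I.add_mem (I.mul_mem_right _ (x ^ (j + 1)) (h.x_pow_mul_sub_mem hs (hδ r) n))
          (I.mul_mem_left (ι ((τ ^ n) r)) _ (I.mul_mem_right _ (x ^ j) hn))
        rwa [← pow_add, sub_mul, mul_assoc _ (x ^ n), ← pow_add,
          show n + (j + 1) = n + 1 + j by ring, sub_add_cancel, pow_succ, ← mul_assoc,
          mul_assoc (x ^ n)] at this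
      | hadd s t hs ht => rw [mul_add, add_mul]; exact I.add_mem hs ht
  · exfalso
    push Not at hδ
    obtain ⟨r, hr, hr'⟩ : ∃ r, δ r ∉ I.comap ι ∧ δ (δ r) ∈ I.comap ι := by
      by_contra! hne
      obtain ⟨r, hr⟩ := hδ
      obtain ⟨m, hm⟩ := h.locally_nilpotent r
      have key : ∀ i, (δ ^ (i + 1)) r ∉ I.comap ι := fun i => by
        induction i with
        | zero => simpa using hr
        | succ i ih =>
          rw [pow_succ', Module.End.mul_apply, pow_succ', Module.End.mul_apply]
          refine hne _ ?_
          rwa [← Module.End.mul_apply, ← pow_succ']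
      refine key m ?_
      rw [Module.End.pow_apply_eq_zero_of_le m.le_succ hm]
      exact TwoSidedIdeal.zero_mem _
    set P := I.comap ι with hPdef
    have step : ∀ j ≤ n, ∃ a, a ∉ P ∧ δ a ∈ P ∧ ι a * x ^ j ∈ I := by
      intro j hj
      induction hj using Nat.decreasingInduction with
      | self => exact ⟨1, fun h1 => hP.ne_top (P.one_mem_iff.1 h1),
          by rw [h.δ_one]; exact P.zero_mem, by simpa using hn⟩
      | of_succ j _ ih =>
        obtain ⟨a, ha, haδ, hax⟩ := ih
        set e := ∑ i ∈ Finset.range (j + 1), (q : k) ^ i with he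
        -- Expand `a x ^ (j + 1) r b` modulo `I`. Because `τ ^ (j + 1) b = a`, the term in `x ^ (j +
        -- 1)` ends in `a x ^ (j + 1)` and lies in `I`. What remains is `[j + 1]_q a τ ^ j(δ r) τ ^
        -- j(b) x ^ j`, and the `q`-integer is invertible.
        set b := (τ ^ (j + 1)).symm a with hb
        have hab : (τ ^ (j + 1)) b = a := AlgEquiv.apply_symm_apply _ _
        have hbδ : δ b ∈ P := h.δ_mem_of_δ_τ_pow_mem hPs (by rwa [hab])
        have hbP : (τ ^ j) b ∉ P := fun hmem => ha (by
          rw [← hab, pow_succ', AlgEquiv.mul_apply]; exact h.τ_mem hPs hmem)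
        refine ⟨a * (τ ^ j) (δ r) * (τ ^ j) b, fun hmem => ?_, h.δ_mul_mem (h.δ_mul_mem haδ
          (h.δ_τ_pow_mem hPs hr' j)) (h.δ_τ_pow_mem hPs hbδ j), ?_⟩
        · rcases hP.mem_or_mem _ _ hmem with hmem | hmem
          · exact (hP.mem_or_mem _ _ hmem).elim ha fun h' => hr (h.mem_of_τ_pow_mem hPs h')
          · exact hbP hmem
        · have h1 : ι a * x ^ (j + 1) * ι r * ι b ∈ I :=
            I.mul_mem_right _ _ (I.mul_mem_right _ _ hax)
          have h2 := I.mul_mem_left (ι a) _ (I.mul_mem_right _ (ι b)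
            (h.x_pow_succ_mul_sub_mem hs hr' j))
          have h3 := I.mul_mem_left (ι a * ι ((τ ^ (j + 1)) r)) _
            (h.x_pow_mul_sub_mem hs hbδ (j + 1))
          have h4 := I.mul_mem_left (ι a * ι ((τ ^ j) (δ r))) _ (h.x_pow_mul_sub_mem hs hbδ j)
          have h5 := I.mul_mem_left (ι a * ι ((τ ^ (j + 1)) r)) _ hax
          rw [hab] at h3
          refine TwoSidedIdeal.mem_of_algebra_smul_mem (h.geom_sum_q_ne_zero j) ?_
          have := I.sub_mem (I.sub_mem (I.sub_mem h1 h2) (I.add_mem h3 h5))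
            (I.algebra_smul_mem e h4)
          convert this using 1
          simp only [map_mul, mul_sub, sub_mul, mul_add, add_mul, smul_sub, smul_mul_assoc,
            mul_smul_comm, mul_assoc]
          abel
    obtain ⟨a, ha, _, hax⟩ := step 0 n.zero_le
    exact ha ((TwoSidedIdeal.mem_comap ι).2 (by simpa using hax))

/-- The left ideals `{s | s x ^ n ∈ I}` increase with `n` and stabilize at some `N`. From `s x ^ N ∈
I` one gets `s S x ^ N ⊆ I`, since any `t` can be moved past `x ^ N` after multiplying by a further
power of `x`; primeness against the eigenvector `x ^ N` concludes. -/
theorem mem_of_mul_x_pow_mem [Nontrivial R] {I : TwoSidedIdeal S} (hI : I.IsHPrime H)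
    (hx : ∀ n, x ^ n ∉ I) {s : S} {n : ℕ} (hs : s * x ^ n ∈ I) : s ∈ I := by
  have := h.noetherian_left
  have : IsNoetherianRing S := h.isNoetherianRing
  let J : ℕ →o Ideal S :=
    { toFun := fun n =>
        { carrier := {s | s * x ^ n ∈ I}
          zero_mem' := by
            change (0 : S) * x ^ n ∈ I
            rw [zero_mul]; exact I.zero_mem
          add_mem' := fun {s t} hs ht => by
            change (s + t) * x ^ n ∈ I
            rw [add_mul]; exact I.add_mem hs ht
          smul_mem' := fun c s hs => by
            change c * s * x ^ n ∈ I
            rw [mul_assoc]; exact I.mul_mem_left _ _ hs }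
      monotone' := monotone_nat_of_le_succ fun n s hs => by
        change s * x ^ (n + 1) ∈ I
        rw [pow_succ, ← mul_assoc]; exact I.mul_mem_right _ _ hs }
  have hJ : ∀ n s, s ∈ J n ↔ s * x ^ n ∈ I := fun _ _ => Iff.rfl
  obtain ⟨N, hN⟩ := monotone_stabilizes_iff_noetherian.2 ‹IsNoetherian S S› J
  have hsN : s * x ^ N ∈ I := by
    rw [← hJ, hN (max N n) (le_max_left _ _)]
    exact J.monotone (le_max_right _ _) hs
  refine (hI.mem_or_mem_of_eigenvector (k := k) (b := x ^ N) (fun g => ?_)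
    fun t => ?_).resolve_right (hx N)
  · obtain ⟨γ, hγ⟩ := h.eigenvector g
    exact ⟨γ ^ N, by rw [smul_pow', hγ, smul_pow]⟩
  · obtain ⟨M, hM⟩ := h.exists_mul_x_pow_mem t
    obtain ⟨u, _, e⟩ := h.exists_mul_x_pow_eq (TwoSidedIdeal.isStable_top H) hM N
    rw [← hJ, hN (M + N) (Nat.le_add_left _ _), hJ, mul_assoc, pow_add, ← mul_assoc t, e,
      ← mul_assoc]
    exact I.mul_mem_right _ _ hsN

/-- The homogeneous components of an element of an `H`-stable ideal lie in the ideal, up to powers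
of `x`. -/
theorem exists_x_pow_mul_mem [Nontrivial R] {I : TwoSidedIdeal S} (hI : I.IsStable H)
    (T : Finset ℕ) (m : ℕ) (f : ℕ → S) (hf : ∀ p, h.IsHomog (p + m) (f p))
    (hs : ∑ p ∈ T, f p ∈ I) : ∀ p ∈ T, ∃ M, x ^ M * f p ∈ I := by
  induction T using Finset.induction_on generalizing m f with
  | empty => simp
  | insert D T hD ih =>
    -- The twisted commutator kills the component of index `D` and multiplies every other one by `x`
    -- and a nonzero scalar. The shift `m` records how many factors `x` have accumulated on the
    -- left.
    have hcomm : ∀ p, h.eigenvalue ^ (D + m) • (x * f p) - (h.twist • f p) * x =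
        (h.eigenvalue ^ (D + m) - h.eigenvalue ^ (p + m)) • (x * f p) := fun p => by
      rw [sub_smul, hf p]
    have hT : ∀ p ∈ T, ∃ M, x ^ M * f p ∈ I := by
      intro p hp
      obtain ⟨M, hM⟩ := ih (m + 1)
        (fun p => (h.eigenvalue ^ (D + m) - h.eigenvalue ^ (p + m)) • (x * f p))
        (fun p => by
          have := ((isHomog_x_pow (h := h) 1).mul (hf p)).smul
            (h.eigenvalue ^ (D + m) - h.eigenvalue ^ (p + m))
          rwa [pow_one, show 1 + (p + m) = p + (m + 1) by ring] at this)
        (by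
          have := h.twisted_commutator_mem hI (D + m) hs
          rw [Finset.mul_sum, Finset.smul_sum, Finset.smul_sum, Finset.sum_mul,
            ← Finset.sum_sub_distrib, Finset.sum_congr rfl fun p _ => hcomm p,
            Finset.sum_insert hD, sub_self, zero_smul, zero_add] at this
          exact this) p hp
      refine ⟨M + 1, ?_⟩
      rw [mul_smul_comm, ← mul_assoc, ← pow_succ] at hM
      refine TwoSidedIdeal.mem_of_algebra_smul_mem (sub_ne_zero.2 fun e => ?_) hM
      have := h.eigenvalue_pow_injective e
      exact hD (by rwa [show D = p by omega])
    have hT' := hT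
    choose! M hM using hT'
    intro p hp
    rcases Finset.mem_insert.1 hp with rfl | hp
    · refine ⟨T.sup M, ?_⟩
      have h1 : x ^ T.sup M * ∑ p ∈ T, f p ∈ I := by
        rw [Finset.mul_sum]
        refine I.finsetSum_mem _ _ fun i hi => ?_
        rw [← Nat.sub_add_cancel (Finset.le_sup (f := M) hi), pow_add, mul_assoc]
        exact I.mul_mem_left _ _ (hM i hi)
      have := I.sub_mem (I.mul_mem_left (x ^ T.sup M) _ hs) h1
      rwa [Finset.sum_insert hD, mul_add, add_sub_cancel_right] at this
    · exact hT p hp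

theorem IsHomog.ext [Nontrivial R] {p : ℕ} {s t : S} (hs : h.IsHomog p s) (ht : h.IsHomog p t)
    (hst : h.coeff p s = h.coeff p t) : s = t := by
  rw [hs.eq_homogLift, ht.eq_homogLift, hst]

theorem exists_isHomog (r : R) : ∃ p w, h.IsHomog p w ∧ h.coeff p w = r := by
  obtain ⟨n, hn⟩ := h.locally_nilpotent r
  exact ⟨n, _, h.isHomog_homogLift (Module.End.pow_apply_eq_zero_of_le n.le_succ hn),
    h.coeff_homogLift_self n r⟩

theorem exists_isHomog_mem_group_smul [Nontrivial R] {I : TwoSidedIdeal S} (hI : I.IsStable H)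
    (g : H) {a : R} (ha : ∃ p w, h.IsHomog p w ∧ w ∈ I ∧ h.coeff p w = a) :
    ∃ p w, h.IsHomog p w ∧ w ∈ I ∧ h.coeff p w = g • a := by
  obtain ⟨p, w, hw, hwI, rfl⟩ := ha
  obtain ⟨γ, hγ⟩ := h.eigenvector g
  refine ⟨p, (γ ^ p)⁻¹ • (g • w), (hw.group_smul g).smul _,
    I.algebra_smul_mem _ (hI _ _ hwI), ?_⟩
  rw [h.coeff_smul, h.coeff_group_smul hγ,
    inv_smul_smul₀ (pow_ne_zero _ (h.group_eigenvalue_ne_zero hγ))]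

theorem isHPrime_constIdeal {P : TwoSidedIdeal R} (hP : P.IsHPrime H) (hδ : ∀ r, δ r ∈ P) :
    (h.constIdeal P hδ).IsHPrime H :=
  (h.isCompletelyPrime_constIdeal hδ (h.completely_prime P hP)).isHPrime
    (h.isStable_constIdeal hP.stable hδ)

theorem twist_pow_smul (n : ℕ) (r : R) : h.twist ^ n • r = (τ ^ n) r := by
  induction n with
  | zero => simp
  | succ n ih => rw [pow_succ', mul_smul, ih, h.twist_smul, pow_succ', AlgEquiv.mul_apply]

theorem twist_pow_inv_smul (n : ℕ) (r : R) : (h.twist ^ n)⁻¹ • r = (τ ^ n).symm r := by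
  rw [inv_smul_eq_iff, h.twist_pow_smul, AlgEquiv.apply_symm_apply]

end

/-- The ideal of the leading coefficients of the homogeneous elements of an `H`-stable ideal. -/
noncomputable def homogLead [Nontrivial R] (h : IsCauchonExtension H ι x τ δ q)
    (I : TwoSidedIdeal S) (hI : I.IsStable H) : TwoSidedIdeal R :=
  .mk' {r | ∃ p w, h.IsHomog p w ∧ w ∈ I ∧ h.coeff p w = r}
    ⟨0, 0, isHomog_zero 0, I.zero_mem, map_zero _⟩
    (fun ⟨p, w, hw, hwI, hr⟩ ⟨p', w', hw', hwI', hr'⟩ => by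
      refine ⟨p + p', w * x ^ p' + w' * x ^ p, (hw.mul (isHomog_x_pow p')).add ?_,
        I.add_mem (I.mul_mem_right _ _ hwI) (I.mul_mem_right _ _ hwI'), ?_⟩
      -- Right multiplication by powers of `x` brings both elements to the degree `p + p'` without
      -- changing their leading coefficients.
      · rw [add_comm p]; exact hw'.mul (isHomog_x_pow p)
      · rw [map_add, h.coeff_mul_x_pow, add_comm p, h.coeff_mul_x_pow, hr, hr'])
    (fun ⟨p, w, hw, hwI, hr⟩ => ⟨p, -w, hw.neg, I.neg_mem hwI, by rw [map_neg, hr]⟩)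
    (fun {r a} ha => by
      obtain ⟨n, v, hv, hr⟩ := h.exists_isHomog r
      -- A left factor of degree `n` applies `τ ^ n` to the leading coefficient of `w`, so `w` is
      -- first moved by the inverse of `twist ^ n`.
      obtain ⟨p, w, hw, hwI, ha⟩ := h.exists_isHomog_mem_group_smul hI (h.twist ^ n)⁻¹ ha
      refine ⟨n + p, v * w, hv.mul hw, I.mul_mem_left _ _ hwI, ?_⟩
      rw [(h.coeff_mul_top (fun _ => hv.coeff_eq_zero) fun _ => hw.coeff_eq_zero).2, hr, ha,
        h.twist_pow_inv_smul, AlgEquiv.apply_symm_apply])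
    (fun {a r} ⟨p, w, hw, hwI, ha⟩ => by
      obtain ⟨n, v, hv, hr⟩ := h.exists_isHomog ((τ ^ p).symm r)
      refine ⟨p + n, w * v, hw.mul hv, I.mul_mem_right _ _ hwI, ?_⟩
      rw [(h.coeff_mul_top (fun _ => hw.coeff_eq_zero) fun _ => hv.coeff_eq_zero).2, hr, ha,
        AlgEquiv.apply_symm_apply])

section

variable [Nontrivial R] (h : IsCauchonExtension H ι x τ δ q)
include h

theorem mem_homogLead {I : TwoSidedIdeal S} {hI : I.IsStable H} {r : R} :
    r ∈ h.homogLead I hI ↔ ∃ p w, h.IsHomog p w ∧ w ∈ I ∧ h.coeff p w = r := by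
  simp [homogLead, TwoSidedIdeal.mem_mk']

theorem isStable_homogLead {I : TwoSidedIdeal S} (hI : I.IsStable H) :
    (h.homogLead I hI).IsStable H := fun g a ha => by
  rw [h.mem_homogLead] at *
  exact h.exists_isHomog_mem_group_smul hI g ha

/-- One inclusion holds because homogeneous components of elements of `I` lie in `I` up to powers of
`x`. For the other, a homogeneous element is determined by its degree and leading coefficient, so
after multiplication by a power of `x` it agrees with an element of `I`, and that power can be
cancelled. -/
theorem eq_homogIdeal {I : TwoSidedIdeal S} (hI : I.IsHPrime H) (hx : ∀ n, x ^ n ∉ I) :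
    I = h.homogIdeal (h.homogLead I hI.stable) (h.isStable_homogLead hI.stable) := by
  have hN := h.isStable_homogLead hI.stable
  refine le_antisymm (fun s hs => ?_) fun s hs => ?_
  · obtain ⟨M, hM⟩ := h.exists_mul_x_pow_mem s
    refine h.mem_homogIdeal.2 ⟨M, ?_⟩
    obtain ⟨f, K, hf, e⟩ := h.exists_homog_sum hM
    rw [e]
    refine sum_mem fun p hp => h.mem_homogSpan (hf p).1 ?_
    obtain ⟨n, hn⟩ := h.exists_x_pow_mul_mem hI.stable _ 0 f (fun p => (hf p).1)
      (e ▸ I.mul_mem_right _ _ hs) p hp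
    refine h.mem_of_τ_pow_mem hN (m := n) (h.mem_homogLead.2
      ⟨_, _, (isHomog_x_pow n).mul (hf p).1, hn, ?_⟩)
    exact (h.coeff_x_pow_mul_top n fun _ => (hf p).1.coeff_eq_zero).2
  · obtain ⟨M, hM⟩ := h.mem_homogIdeal.1 hs
    obtain ⟨f, K, hf, e⟩ := h.exists_homog_sum hM
    refine h.mem_of_mul_x_pow_mem hI hx (n := M) ?_
    rw [e]
    refine I.finsetSum_mem _ _ fun p _ => ?_
    obtain ⟨p', w, hw, hwI, hr⟩ := h.mem_homogLead.1 (hf p).2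
    refine h.mem_of_mul_x_pow_mem hI hx (n := p') ?_
    have h1 := (hf p).1.mul (isHomog_x_pow p')
    have h2 := hw.mul (isHomog_x_pow p)
    rw [add_comm] at h2
    rw [IsHomog.ext h h1 h2 (by
      rw [h.coeff_mul_x_pow, add_comm, h.coeff_mul_x_pow, hr])]
    exact I.mul_mem_right _ _ hwI

theorem isHPrime_homogLead {I : TwoSidedIdeal S} (hI : I.IsHPrime H) (hx : ∀ n, x ^ n ∉ I) :
    (h.homogLead I hI.stable).IsHPrime H where
  ne_top htop := by
    obtain ⟨p, w, hw, hwI, h1⟩ := h.mem_homogLead.1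
      (htop ▸ TwoSidedIdeal.mem_top _ : (1 : R) ∈ h.homogLead I hI.stable)
    refine hx p ?_
    rwa [IsHomog.ext h (isHomog_x_pow p) hw (by rw [h1, h.coeff_x_pow, if_pos rfl])]
  stable := h.isStable_homogLead hI.stable
  le_or_le A B hA hB hAB := by
    have e := h.eq_homogIdeal hI hx
    refine (hI.le_or_le _ _ (h.isStable_homogIdeal hA) (h.isStable_homogIdeal hB)
      fun s hs t ht => ?_).imp (fun hle => ?_) fun hle => ?_
    · rw [e]; exact h.mul_mem_homogIdeal hAB hs ht
    all_goals
      rw [e] at hle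
      exact h.homogIdeal_le_iff.1 hle

theorem isHPrime_homogIdeal {N : TwoSidedIdeal R} (hN : N.IsHPrime H) :
    (h.homogIdeal N hN.stable).IsHPrime H :=
  (h.isCompletelyPrime_homogIdeal hN.stable (h.completely_prime N hN)).isHPrime
    (h.isStable_homogIdeal hN.stable)

theorem isHPrime_comap {I : TwoSidedIdeal S} (hI : I.IsHPrime H) : (I.comap ι).IsHPrime H :=
  (h.isCompletelyPrime_comap hI).isHPrime (h.isStable_comap hI.stable)

/-- The `H`-prime ideals of a Cauchon extension. -/
theorem eq_constIdeal_or_eq_homogIdeal {I : TwoSidedIdeal S} (hI : I.IsHPrime H) :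
    (∃ (P : TwoSidedIdeal R) (_ : P.IsHPrime H) (hδ : ∀ r, δ r ∈ P), I = h.constIdeal P hδ) ∨
      ∃ (N : TwoSidedIdeal R) (hN : N.IsHPrime H), I = h.homogIdeal N hN.stable := by
  by_cases hx : x ∈ I
  · refine Or.inl ⟨_, h.isHPrime_comap hI, h.δ_mem_comap_of_x_mem hx, ?_⟩
    ext s
    rw [h.mem_iff_of_x_mem hx, h.mem_constIdeal, TwoSidedIdeal.mem_comap]
  · have hx' : ∀ n, x ^ n ∉ I := fun n hn => hx (h.x_mem_of_x_pow_mem hI hn)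
    exact Or.inr ⟨_, h.isHPrime_homogLead hI hx', h.eq_homogIdeal hI hx'⟩

end

end IsCauchonExtension

/-! ### The localization of a Cauchon extension -/

theorem IsOreExtension.eq_zero_of_x_pow_mul {k R S : Type*} [Field k] [Ring R] [Algebra k R]
    [Ring S] [Algebra k S] {ι : R →ₐ[k] S} {x : S} {τ : R ≃ₐ[k] R} {δ : R →ₗ[k] R}
    (h : IsOreExtension ι x τ δ) {n : ℕ} {s : S} (hs : x ^ n * s = 0) : s = 0 := by
  obtain ⟨d, hd⟩ := h.exists_coeff_eq_zero s
  have key : ∀ i, (∀ j, i < j → h.coeff j s = 0) → h.coeff i s = 0 := fun i hi => by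
    have := (h.coeff_x_pow_mul_top n hi).2
    rw [hs, map_zero] at this
    exact (τ ^ n).injective (by rw [map_zero, ← this])
  have key' : ∀ m i, d < i + m → h.coeff i s = 0 := fun m => by
    induction m with
    | zero => exact hd
    | succ m ih => exact fun i hi => key i fun j hj => ih j (by omega)
  exact h.ext_coeff fun i => by rw [map_zero, key' (d + 1) i (by omega)]

namespace IsCauchonExtension

variable {H k R S : Type*} [Field k] [Ring R] [Algebra k R]
  [Ring S] [Algebra k S] [CommGroup H] [MulSemiringAction H R] [MulSemiringAction H S]
  {ι : R →ₐ[k] S} {x : S} {τ : R ≃ₐ[k] R} {δ : R →ₗ[k] R} {q : kˣ}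

section

variable (h : IsCauchonExtension H ι x τ δ q)
include h

theorem toLoc_injective : Function.Injective h.toLoc := by
  intro s t hst
  let := h.oreSet
  obtain ⟨⟨_, n, rfl⟩, v, h1, h2⟩ := OreLocalization.oreDiv_eq_iff.1 hst
  simp only [OneMemClass.coe_one, mul_one] at h2
  subst h2
  refine (sub_eq_zero.1 (h.eq_zero_of_x_pow_mul (n := n) ?_)).symm
  rw [mul_sub, sub_eq_zero]
  exact h1

theorem invX_mul_toLoc_x : h.invX * h.toLoc x = 1 := by
  let := h.oreSet
  exact (OreLocalization.mul_div_one (S := Submonoid.powers x)).trans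
    (by rw [one_mul]; exact OreLocalization.div_eq_one' (Submonoid.mem_powers x))

theorem toLoc_x_mul_invX : h.toLoc x * h.invX = 1 := by
  let := h.oreSet
  exact OreLocalization.mul_inv (⟨x, Submonoid.mem_powers x⟩ : Submonoid.powers x) 1

theorem exists_x_pow_mul_eq_toLoc (z : h.Loc) : ∃ n s, h.toLoc x ^ n * z = h.toLoc s := by
  let := h.oreSet
  induction z using OreLocalization.ind with
  | c s n =>
    obtain ⟨_, n, rfl⟩ := n
    refine ⟨n, s, ?_⟩
    rw [← map_pow]
    exact OreLocalization.mul_cancel (S := Submonoid.powers x) (s := ⟨x ^ n, n, rfl⟩) (t := 1)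

theorem invX_pow_mul_toLoc_x_pow (n : ℕ) : h.invX ^ n * h.toLoc x ^ n = 1 := by
  rw [← (show Commute h.invX (h.toLoc x) by
    rw [Commute, SemiconjBy, h.invX_mul_toLoc_x, h.toLoc_x_mul_invX]).mul_pow,
    h.invX_mul_toLoc_x, one_pow]

theorem toLoc_x_pow_mul_invX_pow (n : ℕ) : h.toLoc x ^ n * h.invX ^ n = 1 := by
  rw [← (show Commute (h.toLoc x) h.invX by
    rw [Commute, SemiconjBy, h.invX_mul_toLoc_x, h.toLoc_x_mul_invX]).mul_pow,
    h.toLoc_x_mul_invX, one_pow]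

theorem exists_mul_x_pow_eq_toLoc [Nontrivial R] (z : h.Loc) :
    ∃ M, ∃ g ∈ h.homogSpan ⊤, z * h.toLoc x ^ M = h.toLoc g := by
  obtain ⟨n, s, e⟩ := h.exists_x_pow_mul_eq_toLoc z
  obtain ⟨M, hM⟩ := h.exists_mul_x_pow_mem s
  obtain ⟨g, hg, e'⟩ := h.exists_mul_x_pow_eq (TwoSidedIdeal.isStable_top H) hM n
  refine ⟨M + n, g, hg, ?_⟩
  rw [← one_mul z, ← h.invX_pow_mul_toLoc_x_pow n, mul_assoc _ _ z, e, mul_assoc, pow_add,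
    ← mul_assoc (h.toLoc s), ← map_pow, ← map_pow, ← map_mul, ← map_mul, e', map_mul, map_pow,
    ← mul_assoc, h.invX_pow_mul_toLoc_x_pow, one_mul]

theorem exists_mul_mul_x_pow_eq_toLoc [Nontrivial R] {A B C : TwoSidedIdeal R}
    (hB : B.IsStable H) (hAB : ∀ a ∈ A, ∀ b ∈ B, a * b ∈ C) {y z : h.Loc}
    (hy : ∃ M, ∃ g ∈ h.homogSpan A, y * h.toLoc x ^ M = h.toLoc g)
    (hz : ∃ M, ∃ g ∈ h.homogSpan B, z * h.toLoc x ^ M = h.toLoc g) :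
    ∃ M, ∃ g ∈ h.homogSpan C, y * z * h.toLoc x ^ M = h.toLoc g := by
  obtain ⟨M, g, hg, e⟩ := hy
  obtain ⟨M', g', hg', e'⟩ := hz
  obtain ⟨u, hu, e''⟩ := h.exists_mul_x_pow_eq hB hg' M
  refine ⟨M' + M, g * u, h.mul_mem_homogSpan hB hAB hg hu, ?_⟩
  rw [pow_add, mul_assoc y, ← mul_assoc z, e', ← map_pow, ← map_mul, e'', map_mul, map_pow,
    ← mul_assoc, e, map_mul]

/-- The sum defining `C(r)` ends at `l = p`, so `x ^ p` clears all denominators. This links the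
definition of `C` to homogeneous elements of `S`. -/
theorem cauchonMap_mul_x_pow {p : ℕ} {r : R} (hr : (δ ^ (p + 1)) r = 0) :
    h.cauchonMap r * h.toLoc x ^ p = h.toLoc (h.homogLift p r) := by
  rw [cauchonMap, finsum_eq_sum_of_support_subset (s := Finset.range (p + 1)), Finset.sum_mul,
    homogLift, map_sum, ← Finset.sum_range_reflect]
  · refine Finset.sum_congr rfl fun i hi => ?_
    have hi : i ≤ p := by simpa [Nat.lt_succ_iff] using hi
    rw [show p + 1 - 1 - i = p - i by omega, map_mul, map_pow, mul_assoc]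
    congr 1
    nth_rw 2 [← Nat.sub_add_cancel hi]
    rw [pow_add, ← mul_assoc, h.invX_pow_mul_toLoc_x_pow, one_mul]
  · intro l hl
    by_contra hlp
    refine hl ?_
    simp only [Finset.coe_range, Set.mem_Iio, not_lt] at hlp
    beta_reduce
    rw [Module.End.pow_apply_eq_zero_of_le hlp (h.δ_pow_τ_symm_iterate_eq_zero hr l), smul_zero,
      map_zero, map_zero, zero_mul]

end

/-- The ideal of the localization whose elements are, up to powers of `x`, sums of homogeneous
elements with leading coefficients in `N`. -/
noncomputable def locIdeal [Nontrivial R] (h : IsCauchonExtension H ι x τ δ q)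
    (N : TwoSidedIdeal R) (hN : N.IsStable H) : TwoSidedIdeal h.Loc :=
  .mk' {z | ∃ M, ∃ g ∈ h.homogSpan N, z * h.toLoc x ^ M = h.toLoc g}
    ⟨0, 0, zero_mem _, by rw [zero_mul, map_zero]⟩
    (fun ⟨M, g, hg, e⟩ ⟨M', g', hg', e'⟩ => ⟨M + M', g * x ^ M' + g' * x ^ M,
      add_mem (h.mul_x_pow_mem hg _) (h.mul_x_pow_mem hg' _), by
        rw [add_mul, pow_add, ← mul_assoc, e, ← pow_add, add_comm M, pow_add, ← mul_assoc, e']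
        simp only [map_add, map_mul, map_pow]⟩)
    (fun ⟨M, g, hg, e⟩ => ⟨M, -g, neg_mem hg, by rw [neg_mul, e, map_neg]⟩)
    (fun {y _} hz => h.exists_mul_mul_x_pow_eq_toLoc hN
      (fun _ _ _ hb => N.mul_mem_left _ _ hb) (h.exists_mul_x_pow_eq_toLoc y) hz)
    (fun {_ z} hy => h.exists_mul_mul_x_pow_eq_toLoc (TwoSidedIdeal.isStable_top H)
      (fun _ ha _ _ => N.mul_mem_right _ _ ha) hy (h.exists_mul_x_pow_eq_toLoc z))

section

variable [Nontrivial R] (h : IsCauchonExtension H ι x τ δ q)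
include h

theorem mem_locIdeal {N : TwoSidedIdeal R} {hN : N.IsStable H} {z : h.Loc} :
    z ∈ h.locIdeal N hN ↔ ∃ M, ∃ g ∈ h.homogSpan N, z * h.toLoc x ^ M = h.toLoc g := by
  simp [locIdeal, TwoSidedIdeal.mem_mk']

theorem span_cauchonMap_le {N : TwoSidedIdeal R} (hN : N.IsStable H) :
    TwoSidedIdeal.span (h.cauchonMap '' (N : Set R)) ≤ h.locIdeal N hN := by
  rw [TwoSidedIdeal.span_le]
  rintro _ ⟨r, hr, rfl⟩
  obtain ⟨n, hn⟩ := h.locally_nilpotent r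
  have hn' := Module.End.pow_apply_eq_zero_of_le n.le_succ hn
  exact h.mem_locIdeal.2 ⟨n, _, h.mem_homogSpan (h.isHomog_homogLift hn')
    (by rwa [h.coeff_homogLift_self]), h.cauchonMap_mul_x_pow hn'⟩

theorem toLoc_mem_span_cauchonMap {N : TwoSidedIdeal R} {s : S} (hs : s ∈ h.homogSpan N) :
    h.toLoc s ∈ TwoSidedIdeal.span (h.cauchonMap '' (N : Set R)) := by
  induction hs using AddSubgroup.closure_induction with
  | mem w hw =>
    obtain ⟨p, hw, hp⟩ := hw
    rw [hw.eq_homogLift, ← h.cauchonMap_mul_x_pow (hw.δ_pow_coeff p)]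
    exact TwoSidedIdeal.mul_mem_right _ _ _ (TwoSidedIdeal.subset_span ⟨_, hp, rfl⟩)
  | zero => rw [map_zero]; exact TwoSidedIdeal.zero_mem _
  | add s t _ _ hs ht => rw [map_add]; exact TwoSidedIdeal.add_mem _ hs ht
  | neg s _ hs => rw [map_neg]; exact TwoSidedIdeal.neg_mem _ hs

/-- Both ideals become the same in the localization: the generators `C(r)` are homogeneous elements
divided by powers of `x`, and conversely every homogeneous element is some `C(r) x ^ p`. -/
theorem cauchonTilde_eq {N : TwoSidedIdeal R} (hN : N.IsStable H) :
    h.cauchonTilde N = h.homogIdeal N hN := by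
  refine le_antisymm (fun s hs => ?_) fun s hs => ?_
  · obtain ⟨M, g, hg, e⟩ := h.mem_locIdeal.1
      (h.span_cauchonMap_le hN ((TwoSidedIdeal.mem_comap h.toLoc).1 hs))
    rw [← map_pow, ← map_mul] at e
    exact h.mem_homogIdeal.2 ⟨M, h.toLoc_injective e ▸ hg⟩
  · obtain ⟨M, hM⟩ := h.mem_homogIdeal.1 hs
    refine (TwoSidedIdeal.mem_comap h.toLoc).2 ?_
    have := TwoSidedIdeal.mul_mem_right _ _ (h.invX ^ M) (h.toLoc_mem_span_cauchonMap hM)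
    rwa [map_mul, map_pow, mul_assoc, h.toLoc_x_pow_mul_invX_pow, mul_one] at this

end

end IsCauchonExtension

/-! ### The projection of the Bruhat order along a simple reflection -/

namespace CoxeterSystem

variable {B W : Type*} [Group W] {M : CoxeterMatrix B} (cs : CoxeterSystem M W)

theorem bruhatProj_le_self (i : B) (u : W) : cs.BruhatLE (cs.bruhatProj (cs.simple i) u) u := by
  rw [bruhatProj]
  split_ifs with h
  exacts [.refl, (cs.not_bruhatLE_iff u i).1 h]

theorem bruhatProj_le_mul_simple (i : B) (u : W) : cs.BruhatLE (cs.bruhatProj (cs.simple i) u)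
    (cs.bruhatProj (cs.simple i) u * cs.simple i) := by
  rw [bruhatProj]
  split_ifs with h
  exacts [h, by simpa using (cs.not_bruhatLE_iff u i).1 h]

/-- A Galois connection: `Φ(u)` is the least element of the coset of `u`, `v s` the greatest element
of that of `v`, and lifting passes between the two comparisons. -/
theorem bruhatProj_le_iff {i : B} {u v : W} (hv : cs.BruhatLE v (v * cs.simple i)) :
    cs.BruhatLE (cs.bruhatProj (cs.simple i) u) v ↔ cs.BruhatLE u (v * cs.simple i) := by
  refine ⟨fun h => ?_, fun h => BruhatLE.le_of_le_mul_simple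
    ((cs.bruhatProj_le_self i u).trans h) (cs.bruhatProj_le_mul_simple i u)⟩
  rw [bruhatProj] at h
  split_ifs at h
  · exact h.trans hv
  · simpa using h.mul_simple_mul_simple hv

end CoxeterSystem

theorem mainTheorem1 {k R S H : Type*} [Field k] [Ring R] [Algebra k R] [Ring S] [Algebra k S]
    [CommGroup H] [MulSemiringAction H R] [MulSemiringAction H S]
    (ι : R →ₐ[k] S) (x : S) (τ : R ≃ₐ[k] R) (δ : R →ₗ[k] R) (q : kˣ)
    (hS : IsCauchonExtension H ι x τ δ q)
    (hτ : ⨆ μ : k, Module.End.eigenspace (τ.toLinearMap : Module.End k R) μ = ⊤)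
    {B W : Type*} [Group W] {M : CoxeterMatrix B} (cs : CoxeterSystem M W) (i : B) (w a : W)
    (ha : a = cs.simple i) (hw : cs.BruhatLE w (w * a))
    (nabla : cs.BruhatInterval w ≃o HSpec H R)
    (h₁ : nabla '' cs.bruhatPiece₁ w a = specPiece₁ H δ)
    (h₂ : nabla '' cs.bruhatPiece₂ w a = specPiece₂ H δ)
    (h₃ : nabla '' cs.bruhatPiece₃ w a = specPiece₃ H δ) :
    ∃ nablaExt : cs.BruhatInterval (w * a) ≃o HSpec H S,
      (∀ (u : cs.BruhatInterval (w * a)) (hu : cs.BruhatLE u.1 w),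
        (nablaExt u).1 = hS.cauchonTilde (nabla ⟨u.1, hu⟩).1) ∧
      (∀ u : cs.BruhatInterval (w * a), ¬ cs.BruhatLE u.1 w →
        ∃ hu : cs.BruhatLE (u.1 * a) w,
          (nablaExt u).1 =
            TwoSidedIdeal.span (ι '' ((nabla ⟨u.1 * a, hu⟩).1 : Set R) ∪ {x})) ∧
      (∀ u : cs.BruhatInterval (w * a), ∃ hu : cs.BruhatLE (cs.bruhatProj a u.1) w,
        (nablaExt u).1.comap ι = (nabla ⟨cs.bruhatProj a u.1, hu⟩).1) := by
  subst ha
  have : Nontrivial R := by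
    by_contra hR
    rw [not_nontrivial_iff_subsingleton] at hR
    refine (nabla ⟨w, .refl⟩).2.ne_top (TwoSidedIdeal.ext fun r => ?_)
    rw [Subsingleton.elim r 0]
    exact iff_of_true (TwoSidedIdeal.zero_mem _) (TwoSidedIdeal.zero_mem _)
  have hle : ∀ {u v : cs.BruhatInterval w}, (nabla u).1 ≤ (nabla v).1 ↔ cs.BruhatLE u.1 v.1 :=
    nabla.le_iff_le
  have mem₁ : ∀ v : cs.BruhatInterval w, v ∈ cs.bruhatPiece₁ w (cs.simple i) ↔
      nabla v ∈ specPiece₁ H δ := fun v => by rw [← h₁, nabla.injective.mem_set_image]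
  have mem₃ : ∀ v : cs.BruhatInterval w, v ∈ cs.bruhatPiece₃ w (cs.simple i) ↔
      nabla v ∈ specPiece₃ H δ := fun v => by rw [← h₃, nabla.injective.mem_set_image]
  -- The complement of the first piece is `v ≤ v s` on one side and `δ`-stability on the other,
  -- since the ideals of the third piece are trivially `δ`-stable.
  have hstable : ∀ v : cs.BruhatInterval w, cs.BruhatLE v.1 (v.1 * cs.simple i) ↔
      ∀ r ∈ (nabla v).1, δ r ∈ (nabla v).1 := fun v => by
    rw [← not_iff_not, cs.not_bruhatLE_iff]
    refine (mem₁ v).trans (not_congr ⟨?_, fun hv => ?_⟩)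
    · rintro (hv | hv)
      exacts [hv.1, fun r _ => hv r]
    · by_cases h : nabla v ∈ specPiece₃ H δ
      exacts [Or.inr h, Or.inl ⟨hv, h⟩]
  have hconst : ∀ v : cs.BruhatInterval w, ¬ cs.BruhatLE (v.1 * cs.simple i) w ↔
      ∀ r, δ r ∈ (nabla v).1 := mem₃
  have hmul : ∀ u : cs.BruhatInterval (w * cs.simple i), ¬ cs.BruhatLE u.1 w →
      cs.BruhatLE (u.1 * cs.simple i) w := fun u hu => by
    have := (CoxeterSystem.BruhatLE.le_mul_simple u.2 i)
    simp only [mul_assoc, cs.simple_mul_simple_self, mul_one] at this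
    exact this.resolve_left hu
  have hδ : ∀ (u : cs.BruhatInterval (w * cs.simple i)) (hu : ¬ cs.BruhatLE u.1 w),
      ∀ r, δ r ∈ (nabla ⟨u.1 * cs.simple i, hmul u hu⟩).1 := fun u hu =>
    (hconst _).1 (by simpa using hu)
  classical
  let F : cs.BruhatInterval (w * cs.simple i) → HSpec H S := fun u =>
    if hu : cs.BruhatLE u.1 w then
      ⟨_, hS.isHPrime_homogIdeal (nabla ⟨u.1, hu⟩).2⟩
    else ⟨_, hS.isHPrime_constIdeal (nabla ⟨u.1 * cs.simple i, hmul u hu⟩).2 (hδ u hu)⟩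
  have F_of_le : ∀ u (hu : cs.BruhatLE u.1 w), (F u).1 =
      hS.homogIdeal (nabla ⟨u.1, hu⟩).1 (nabla ⟨u.1, hu⟩).2.stable := fun u hu => by
    simp only [F, dif_pos hu]
  have F_of_not_le : ∀ u (hu : ¬ cs.BruhatLE u.1 w), (F u).1 =
      hS.constIdeal (nabla ⟨u.1 * cs.simple i, hmul u hu⟩).1 (hδ u hu) := fun u hu => by
    simp only [F, dif_neg hu]
  have hproj : ∀ u : cs.BruhatInterval (w * cs.simple i),
      cs.BruhatLE (cs.bruhatProj (cs.simple i) u.1) w := fun u => (cs.bruhatProj_le_iff hw).2 u.2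
  -- The contraction is some `nabla v`. It lies in `nabla u` and is `δ`-stable, so `v ≤ u` and `v ≤
  -- v s`, which forces `v ≤ Φ(u)`; conversely `nabla (Φ(u))` is a `δ`-stable ideal inside `nabla
  -- u`.
  have hcomap : ∀ u, (F u).1.comap ι = (nabla ⟨_, hproj u⟩).1 := by
    intro u
    by_cases hu : cs.BruhatLE u.1 w
    · rw [F_of_le u hu]
      have hI := hS.isHPrime_homogIdeal (nabla ⟨u.1, hu⟩).2
      obtain ⟨v, hv⟩ := nabla.surjective ⟨_, hS.isHPrime_comap hI⟩
      have hv' : (nabla v).1 = (hS.homogIdeal _ (nabla ⟨u.1, hu⟩).2.stable).comap ι :=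
        congrArg Subtype.val hv
      refine hv'.symm.trans (le_antisymm (hle.2 ?_) fun r hr => ?_)
      · have h1 : cs.BruhatLE v.1 u.1 := hle.1 (show (nabla v).1 ≤ (nabla ⟨u.1, hu⟩).1 from
          fun r hr => hS.mem_of_ι_mem_homogIdeal ((TwoSidedIdeal.mem_comap ι).1 (hv' ▸ hr)))
        have h2 : cs.BruhatLE v.1 (v.1 * cs.simple i) := (hstable v).2
          (hv' ▸ hS.δ_mem_comap hI.stable)
        exact CoxeterSystem.BruhatLE.le_of_le_mul_simple (h1.trans ((cs.bruhatProj_le_iff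
          (cs.bruhatProj_le_mul_simple i u.1)).1 .refl)) h2
      · rw [hv', TwoSidedIdeal.mem_comap]
        exact hS.ι_mem_homogIdeal (nabla ⟨_, hproj u⟩).2.stable
          ((hstable ⟨_, hproj u⟩).1 (cs.bruhatProj_le_mul_simple i u.1))
          (hle.2 (cs.bruhatProj_le_self i u.1)) hr
    · rw [F_of_not_le u hu]
      have h1 : cs.bruhatProj (cs.simple i) u.1 = u.1 * cs.simple i :=
        if_neg fun h => hu (h.trans (hmul u hu))
      simp only [h1]
      ext r
      rw [TwoSidedIdeal.mem_comap, hS.ι_mem_constIdeal]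
  have hF : ∀ u v, F u ≤ F v ↔ u ≤ v := by
    intro u v
    change (F u).1 ≤ (F v).1 ↔ cs.BruhatLE u.1 v.1
    by_cases hv : cs.BruhatLE v.1 w
    · rw [F_of_le v hv]
      by_cases hu : cs.BruhatLE u.1 w
      · rw [F_of_le u hu, hS.homogIdeal_le_iff]
        exact hle
      · rw [F_of_not_le u hu]
        refine iff_of_false (fun h => ?_) fun h => hu (h.trans hv)
        refine hS.x_pow_not_mem_homogIdeal (nabla ⟨v.1, hv⟩).2.stable
          (nabla ⟨v.1, hv⟩).2.ne_top 1 ?_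
        rw [pow_one]
        exact h hS.x_mem_constIdeal
    · have hP := (nabla ⟨v.1 * cs.simple i, hmul v hv⟩).2
      have hvs : cs.BruhatLE (v.1 * cs.simple i) (v.1 * cs.simple i * cs.simple i) := by
        rw [mul_assoc, cs.simple_mul_simple_self, mul_one, ← cs.not_bruhatLE_iff]
        exact fun h => hv (h.trans (hmul v hv))
      -- Containment in `P_x` is tested on contractions, and `bruhatProj_le_iff` at `v s` turns
      -- `Φ(u) ≤ v s` into `u ≤ v`.
      trans (F u).1.comap ι ≤ (nabla ⟨v.1 * cs.simple i, hmul v hv⟩).1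
      · rw [F_of_not_le v hv]
        exact ⟨fun h r hr => hS.ι_mem_constIdeal.1 (h ((TwoSidedIdeal.mem_comap ι).1 hr)),
          hS.le_constIdeal hP.stable (hS.completely_prime _ hP) (hδ v hv) (F u).2.stable⟩
      · rw [hcomap u]
        refine hle.trans ((cs.bruhatProj_le_iff hvs).trans ?_)
        rw [mul_assoc, cs.simple_mul_simple_self, mul_one]
  have hsurj : Function.Surjective F := by
    intro I
    rcases hS.eq_constIdeal_or_eq_homogIdeal I.2 with ⟨P, hP, hδP, e⟩ | ⟨N, hN, e⟩
    · obtain ⟨p, hp⟩ := nabla.surjective ⟨P, hP⟩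
      obtain rfl : (nabla p).1 = P := congrArg Subtype.val hp
      have hpw := (hconst p).2 hδP
      -- The ideal `P_x` with `P = nabla p` comes from `p s`, which is not below `w` exactly because
      -- `δ(R) ⊆ P`.
      let u : cs.BruhatInterval (w * cs.simple i) :=
        ⟨p.1 * cs.simple i, CoxeterSystem.BruhatLE.mul_simple_mul_simple p.2 hw⟩
      have hp' : (⟨u.1 * cs.simple i, hmul u hpw⟩ : cs.BruhatInterval w) = p :=
        Subtype.ext (cs.simple_mul_simple_cancel_right i)
      refine ⟨u, Subtype.ext ((F_of_not_le u hpw).trans (Eq.trans ?_ e.symm))⟩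
      ext s
      rw [hS.mem_constIdeal, hS.mem_constIdeal, hp']
    · obtain ⟨p, hp⟩ := nabla.surjective ⟨N, hN⟩
      obtain rfl : (nabla p).1 = N := congrArg Subtype.val hp
      exact ⟨⟨p.1, p.2.trans hw⟩, Subtype.ext ((F_of_le _ p.2).trans e.symm)⟩
  refine ⟨RelIso.ofSurjective (OrderEmbedding.ofMapLEIff F hF) hsurj,
    fun u hu => ?_, fun u hu => ?_, fun u => ⟨hproj u, hcomap u⟩⟩
  · rw [hS.cauchonTilde_eq (nabla ⟨u.1, hu⟩).2.stable]
    exact F_of_le u hu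
  · refine ⟨hmul u hu, ?_⟩
    rw [← hS.constIdeal_eq_span (hδ u hu)]
    exact F_of_not_le u hu
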